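/- Let $\mu>0$ and $\lambda$ be real numbers with $\lambda+\mu>0$, let $R>0$, and let $\Omega\subset\mathbb{R}^2$ be an open disk of radius $R$. Consider the Steklov–Lamé eigenvalue problem $$-\operatorname{div} A(e(\mathbf u))=0 \ \text{ in } \Omega,\qquad A(e(\mathbf u))\,\mathbf n=\Lambda \mathbf u\ \text{ on }\partial\Omega,$$ where $e(\mathbf u)=\frac12(\nabla\mathbf u+\nabla\mathbf u^T)$ and $A\xi=2\mu\xi+\lambda\operatorname{tr}(\xi)\operatorname{Id}$, understood in the weak sense: $\mathbf u\in H^1(\Omega)^2$ and $\int_\Omega A(e(\mathbf u)):e(\mathbf v)=\Lambda\int_{\partial\Omega}\mathbf u\cdot\mathbf v$ for all $\mathbf v\in H^1(\Omega)^2$. The eigenspace of $\Lambda\in\mathbb{R}$ is the space of all these $\mathbf u$; its dimension is the multiplicity of $\Lambda$. The spectrum, with every eigenvalue repeated according to its multiplicity, is a nondecreasing sequence that tends to $+\infty$; it is the sorted list of the following real numbers: 1. $0$ (three times); 2. $\frac{2(\lambda+\mu)}{R}$ (once); 3. $\frac{4\mu(\lambda+\mu)}{(\lambda+3\mu)R}$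 (twice); 4. $\frac{2\mu(n-1)}{R}$ (twice), for each $n=2,3,\dots$; 5. $\frac{2(n+1)\mu(\lambda+\mu)}{(\lambda+3\mu)R}$ (twice), for each $n=2,3,\dots$. In polar coordinates $(r,\theta)$ around the centre of the disk, and with Cartesian components, let the following sets of functions be attached to these entries: 1. $\{(1,0),\ (0,1),\ r(-\sin\theta,\cos\theta)\}$; 2. $\{r(\cos\theta,\sin\theta)\}$; 3. $\Big\{\Big(2(R^2-r^2)+\frac{(\lambda+3\mu)r^2\cos 2\theta}{\lambda+\mu},\ \frac{(\lambda+3\mu)r^2\sin 2\theta}{\lambda+\mu}\Big),\ \Big(\frac{(\lambda+3\mu)r^2\sin 2\theta}{\lambda+\mu},\ 2(R^2-r^2)-\frac{(\lambda+3\mu)r^2\cos 2\theta}{\lambda+\mu}\Big)\Big\}$; 4. $\{r^{n-1}(\cos((n-1)\theta),-\sin((n-1)\theta)),\ r^{n-1}(\sin((n-1)\theta),\cos((n-1)\theta))\}$; 5. $\{(f_1,f_2),(f_3,f_4)\}$, where $$f_1=\tfrac{r^{n-1}}{(\lambda+\mu)n}\big(-(\lambda+\mu)(n+1)(r^2-R^2)\cos((n-1)\theta)+(\lambda+3\mu)r^2\cos((n+1)\theta)\big),$$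 $$f_2=\tfrac{r^{n-1}}{(\lambda+\mu)n}\big((\lambda+\mu)(n+1)(r^2-R^2)\sin((n-1)\theta)+(\lambda+3\mu)r^2\sin((n+1)\theta)\big),$$ $$f_3=\tfrac{r^{n-1}}{(\lambda+\mu)n}\big((\lambda+\mu)(n+1)(r^2-R^2)\sin((n-1)\theta)-(\lambda+3\mu)r^2\sin((n+1)\theta)\big),$$ $$f_4=\tfrac{r^{n-1}}{(\lambda+\mu)n}\big((\lambda+\mu)(n+1)(r^2-R^2)\cos((n-1)\theta)+(\lambda+3\mu)r^2\cos((n+1)\theta)\big).$$ All these functions together are linearly independent, and for every real $\Lambda$ the eigenspace of $\Lambda$ is the linear span of those functions that are attached to entries of the list equal to $\Lambda$ (so it is $\{0\}$ when $\Lambda$ is not in the list). -/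

import Mathlib

open MeasureTheory Filter Topology
open scoped ContDiff

noncomputable section

namespace SteklovLame

/-- The Euclidean plane. -/
abbrev Plane := EuclideanSpace ℝ (Fin 2)

/-! ### Linearized elasticity -/

/-- The symmetrized gradient `e = (M + Mᵀ) / 2` of a displacement with Jacobian `M`. -/
def strain (M : Matrix (Fin 2) (Fin 2) ℝ) : Matrix (Fin 2) (Fin 2) ℝ :=
  (1 / 2 : ℝ) • (M + M.transpose)

/-- Hooke's law `A ξ = 2 μ ξ + λ tr(ξ) Id`. -/
def hooke (lam mu : ℝ) (ξ : Matrix (Fin 2) (Fin 2) ℝ) : Matrix (Fin 2) (Fin 2) ℝ :=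
  (2 * mu) • ξ + (lam * ξ.trace) • (1 : Matrix (Fin 2) (Fin 2) ℝ)

/-- The matrix scalar product `S : T`. -/
def frob (S T : Matrix (Fin 2) (Fin 2) ℝ) : ℝ := ∑ i, ∑ j, S i j * T i j

/-! ### The space `H¹(Ω)` of vector fields, and traces -/

/-- `g` is the weak partial derivative `∂f/∂x_j` in `Ω`. -/
def HasWeakPartial (Ω : Set Plane) (j : Fin 2) (f g : Plane → ℝ) : Prop :=
  ∀ φ : Plane → ℝ, ContDiff ℝ ∞ φ → HasCompactSupport φ → tsupport φ ⊆ Ω →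
    ∫ x in Ω, f x * fderiv ℝ φ x (EuclideanSpace.single j 1) = - ∫ x in Ω, g x * φ x

/-- `u` belongs to `H¹(Ω)`, with weak Jacobian `G` (`G x i j` is `∂u_i/∂x_j` at `x`). -/
structure HasWeakJacobian (Ω : Set Plane) (u : Plane → Plane)
    (G : Plane → Matrix (Fin 2) (Fin 2) ℝ) : Prop where
  memLp : MemLp u 2 (volume.restrict Ω)
  memLp_jacobian : ∀ i j, MemLp (fun x => G x i j) 2 (volume.restrict Ω)
  weak_partial : ∀ i j, HasWeakPartial Ω j (fun x => u x i) (fun x => G x i j)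

/-- `g` is the trace, on the boundary with surface measure `σ`, of the field `u` in `H¹(Ω)` with
weak Jacobian `G`: there are smooth fields `φ k` on the plane that converge to `u` in `H¹(Ω)` and
whose boundary values converge to `g` in `L²(σ)`. (On a bounded Lipschitz domain every `u` in
`H¹(Ω)` has exactly one trace in `L²(σ)`.) -/
def IsTrace (Ω : Set Plane) (σ : Measure Plane) (u : Plane → Plane)
    (G : Plane → Matrix (Fin 2) (Fin 2) ℝ) (g : Plane → Plane) : Prop :=
  MemLp g 2 σ ∧ ∃ φ : ℕ → Plane → Plane, (∀ k, ContDiff ℝ ∞ (φ k)) ∧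
    Tendsto (fun k => eLpNorm (fun x => φ k x - u x) 2 (volume.restrict Ω)) atTop (𝓝 0) ∧
    (∀ i j, Tendsto (fun k => eLpNorm
      (fun x => fderiv ℝ (φ k) x (EuclideanSpace.single j 1) i - G x i j) 2 (volume.restrict Ω))
      atTop (𝓝 0)) ∧
    Tendsto (fun k => eLpNorm (fun x => φ k x - g x) 2 σ) atTop (𝓝 0)

/-! ### The Steklov-Lamé problem -/

/-- `u ∈ H¹(Ω)` solves `-div A(e(u)) = 0` in `Ω`, `A(e(u)) n = Λ u` on `∂Ω`, in the sense that
`∫_Ω A(e(u)) : e(v) = Λ ∫_∂Ω u · v` for every `v ∈ H¹(Ω)`. -/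
def IsSolution (Ω : Set Plane) (σ : Measure Plane) (lam mu Λ : ℝ) (u : Plane → Plane) : Prop :=
  ∃ (G : Plane → Matrix (Fin 2) (Fin 2) ℝ) (g : Plane → Plane),
    HasWeakJacobian Ω u G ∧ IsTrace Ω σ u G g ∧
    ∀ (v : Plane → Plane) (H : Plane → Matrix (Fin 2) (Fin 2) ℝ) (h : Plane → Plane),
      HasWeakJacobian Ω v H → IsTrace Ω σ v H h →
        ∫ x in Ω, frob (hooke lam mu (strain (G x))) (strain (H x))
          = Λ * ∫ x, inner ℝ (g x) (h x) ∂σ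

section helpers

variable {Ω : Set Plane} {σ : Measure Plane} {lam mu Λ : ℝ}

lemma frob_hooke_strain_comb (lam mu a b : ℝ) (M N P : Matrix (Fin 2) (Fin 2) ℝ) :
    frob (hooke lam mu (strain (a • M + b • N))) (strain P)
      = a * frob (hooke lam mu (strain M)) (strain P)
        + b * frob (hooke lam mu (strain N)) (strain P) := by
  simp [frob, hooke, strain, Fin.sum_univ_two, Matrix.trace, Matrix.one_apply]
  ring

lemma integrable_frob {G H : Plane → Matrix (Fin 2) (Fin 2) ℝ}
    (hG : ∀ i j, MemLp (fun x => G x i j) 2 (volume.restrict Ω))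
    (hH : ∀ i j, MemLp (fun x => H x i j) 2 (volume.restrict Ω)) :
    Integrable (fun x => frob (hooke lam mu (strain (G x))) (strain (H x)))
      (volume.restrict Ω) := by
  have hsG : ∀ i j, MemLp (fun x => strain (G x) i j) 2 (volume.restrict Ω) := fun i j => by
    simpa [strain] using ((hG i j).add (hG j i)).const_mul (1 / 2 : ℝ)
  have hsH : ∀ i j, MemLp (fun x => strain (H x) i j) 2 (volume.restrict Ω) := fun i j => by
    simpa [strain] using ((hH i j).add (hH j i)).const_mul (1 / 2 : ℝ)
  have hA : ∀ i j, MemLp (fun x => hooke lam mu (strain (G x)) i j) 2 (volume.restrict Ω) :=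
    fun i j => by
      have h1 := (hsG i j).const_mul (2 * mu)
      have h2 := ((hsG 0 0).add (hsG 1 1)).const_mul
        (lam * (1 : Matrix (Fin 2) (Fin 2) ℝ) i j)
      refine (h1.add h2).ae_eq (Eventually.of_forall fun x => ?_)
      simp [hooke, Matrix.trace, Fin.sum_univ_two]
      ring
  unfold frob
  exact integrable_finsetSum _ fun i _ => integrable_finsetSum _ fun j _ =>
    (hA i j).integrable_mul (hsH i j)

lemma HasWeakJacobian.comb {u₁ u₂ u : Plane → Plane} {G₁ G₂ : Plane → Matrix (Fin 2) (Fin 2) ℝ}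
    (a b : ℝ) (h₁ : HasWeakJacobian Ω u₁ G₁) (h₂ : HasWeakJacobian Ω u₂ G₂)
    (hu : u =ᵐ[volume.restrict Ω] fun x => a • u₁ x + b • u₂ x) :
    HasWeakJacobian Ω u (fun x => a • G₁ x + b • G₂ x) := by
  refine ⟨((h₁.memLp.const_smul a).add (h₂.memLp.const_smul b)).ae_eq hu.symm,
    fun i j => ?_, fun i j φ hφ hc hs => ?_⟩
  · refine (((h₁.memLp_jacobian i j).const_mul a).add
      ((h₂.memLp_jacobian i j).const_mul b)).ae_eq (Eventually.of_forall fun x => ?_)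
    simp
  · have hcoord : ∀ {w : Plane → Plane}, MemLp w 2 (volume.restrict Ω) →
        MemLp (fun x => w x i) 2 (volume.restrict Ω) := fun {w} hw =>
      (EuclideanSpace.proj (𝕜 := ℝ) i).comp_memLp' hw
    have hφ2 : MemLp φ 2 (volume.restrict Ω) := hφ.continuous.memLp_of_hasCompactSupport hc
    have hd2 : MemLp (fun x => fderiv ℝ φ x (EuclideanSpace.single j 1)) 2
        (volume.restrict Ω) := by
      refine Continuous.memLp_of_hasCompactSupport ?_ ?_
      · exact (hφ.continuous_fderiv (by simp)).clm_apply continuous_const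
      · exact hc.fderiv_apply ℝ _
    have e₁ := h₁.weak_partial i j φ hφ hc hs
    have e₂ := h₂.weak_partial i j φ hφ hc hs
    have i₁ : Integrable (fun x => a * (u₁ x i * fderiv ℝ φ x (EuclideanSpace.single j 1)))
        (volume.restrict Ω) := ((hcoord h₁.memLp).integrable_mul hd2).const_mul a
    have i₂ : Integrable (fun x => b * (u₂ x i * fderiv ℝ φ x (EuclideanSpace.single j 1)))
        (volume.restrict Ω) := ((hcoord h₂.memLp).integrable_mul hd2).const_mul b
    have j₁ : Integrable (fun x => a * (G₁ x i j * φ x)) (volume.restrict Ω) :=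
      ((h₁.memLp_jacobian i j).integrable_mul hφ2).const_mul a
    have j₂ : Integrable (fun x => b * (G₂ x i j * φ x)) (volume.restrict Ω) :=
      ((h₂.memLp_jacobian i j).integrable_mul hφ2).const_mul b
    have L : ∫ x in Ω, u x i * fderiv ℝ φ x (EuclideanSpace.single j 1)
        = a * (∫ x in Ω, u₁ x i * fderiv ℝ φ x (EuclideanSpace.single j 1))
          + b * ∫ x in Ω, u₂ x i * fderiv ℝ φ x (EuclideanSpace.single j 1) := by
      rw [← integral_const_mul, ← integral_const_mul, ← integral_add i₁ i₂]
      refine integral_congr_ae (hu.mono fun x hx => ?_)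
      simp [hx]
      ring
    have Rr : ∫ x in Ω, (a • G₁ x + b • G₂ x) i j * φ x
        = a * (∫ x in Ω, G₁ x i j * φ x) + b * ∫ x in Ω, G₂ x i j * φ x := by
      rw [← integral_const_mul, ← integral_const_mul, ← integral_add j₁ j₂]
      refine integral_congr_ae (Eventually.of_forall fun x => ?_)
      simp
      ring
    rw [L, Rr, e₁, e₂]
    ring

/-- Passing to the limit in a linear combination, in the `L²` seminorm. -/
lemma tendsto_eLpNorm_comb {F : Type*} [NormedAddCommGroup F] [NormedSpace ℝ F]
    {ν : Measure Plane} {p₁ p₂ p : ℕ → Plane → F} (a b : ℝ)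
    (m₁ : ∀ k, AEStronglyMeasurable (p₁ k) ν) (m₂ : ∀ k, AEStronglyMeasurable (p₂ k) ν)
    (h₁ : Tendsto (fun k => eLpNorm (p₁ k) 2 ν) atTop (𝓝 0))
    (h₂ : Tendsto (fun k => eLpNorm (p₂ k) 2 ν) atTop (𝓝 0))
    (hp : ∀ k, p k =ᵐ[ν] fun x => a • p₁ k x + b • p₂ k x) :
    Tendsto (fun k => eLpNorm (p k) 2 ν) atTop (𝓝 0) := by
  have hlim : Tendsto (fun k => ‖a‖ₑ * eLpNorm (p₁ k) 2 ν + ‖b‖ₑ * eLpNorm (p₂ k) 2 ν)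
      atTop (𝓝 0) := by
    have := (ENNReal.Tendsto.const_mul h₁ (Or.inr (enorm_ne_top (x := a)))).add
      (ENNReal.Tendsto.const_mul h₂ (Or.inr (enorm_ne_top (x := b))))
    simpa using this
  refine tendsto_of_tendsto_of_tendsto_of_le_of_le tendsto_const_nhds hlim
    (fun _ => bot_le) fun k => ?_
  calc eLpNorm (p k) 2 ν = eLpNorm (a • p₁ k + b • p₂ k) 2 ν := eLpNorm_congr_ae (hp k)
    _ ≤ eLpNorm (a • p₁ k) 2 ν + eLpNorm (b • p₂ k) 2 ν :=
        eLpNorm_add_le ((m₁ k).const_smul a) ((m₂ k).const_smul b) (by norm_num)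
    _ = _ := by rw [eLpNorm_const_smul, eLpNorm_const_smul]

lemma IsTrace.comb {u₁ u₂ u g₁ g₂ : Plane → Plane} {G₁ G₂ : Plane → Matrix (Fin 2) (Fin 2) ℝ}
    (a b : ℝ) (w₁ : HasWeakJacobian Ω u₁ G₁) (w₂ : HasWeakJacobian Ω u₂ G₂)
    (h₁ : IsTrace Ω σ u₁ G₁ g₁) (h₂ : IsTrace Ω σ u₂ G₂ g₂)
    (hu : u =ᵐ[volume.restrict Ω] fun x => a • u₁ x + b • u₂ x) :
    IsTrace Ω σ u (fun x => a • G₁ x + b • G₂ x) (fun x => a • g₁ x + b • g₂ x) := by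
  obtain ⟨m₁, φ₁, s₁, c₁, d₁, t₁⟩ := h₁
  obtain ⟨m₂, φ₂, s₂, c₂, d₂, t₂⟩ := h₂
  have hd : ∀ {φ : Plane → Plane} (_ : ContDiff ℝ ∞ φ) (i j : Fin 2),
      Continuous fun x => fderiv ℝ φ x (EuclideanSpace.single j 1) i := fun {φ} hφ i j =>
    (EuclideanSpace.proj (𝕜 := ℝ) i).continuous.comp
      ((hφ.continuous_fderiv (by simp)).clm_apply continuous_const)
  refine ⟨(m₁.const_smul a).add (m₂.const_smul b), fun k x => a • φ₁ k x + b • φ₂ k x,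
    fun k => ((s₁ k).const_smul a).add ((s₂ k).const_smul b), ?_, fun i j => ?_, ?_⟩
  · refine tendsto_eLpNorm_comb a b
      (fun k => (s₁ k).continuous.aestronglyMeasurable.sub w₁.memLp.aestronglyMeasurable)
      (fun k => (s₂ k).continuous.aestronglyMeasurable.sub w₂.memLp.aestronglyMeasurable)
      c₁ c₂ fun k => hu.mono fun x hx => ?_
    simp only [hx, Pi.sub_apply]
    module
  · refine tendsto_eLpNorm_comb a b
      (fun k => (hd (s₁ k) i j).aestronglyMeasurable.sub
        (w₁.memLp_jacobian i j).aestronglyMeasurable)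
      (fun k => (hd (s₂ k) i j).aestronglyMeasurable.sub
        (w₂.memLp_jacobian i j).aestronglyMeasurable)
      (d₁ i j) (d₂ i j) fun k => Eventually.of_forall fun x => ?_
    have e₁ := ((s₁ k).differentiable (by simp)) x
    have e₂ := ((s₂ k).differentiable (by simp)) x
    have : fderiv ℝ (fun x => a • φ₁ k x + b • φ₂ k x) x
        = a • fderiv ℝ (φ₁ k) x + b • fderiv ℝ (φ₂ k) x :=
      ((e₁.hasFDerivAt.const_smul a).add (e₂.hasFDerivAt.const_smul b)).fderiv
    simp [this]
    ring
  · refine tendsto_eLpNorm_comb a b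
      (fun k => (s₁ k).continuous.aestronglyMeasurable.sub m₁.aestronglyMeasurable)
      (fun k => (s₂ k).continuous.aestronglyMeasurable.sub m₂.aestronglyMeasurable)
      t₁ t₂ fun k => Eventually.of_forall fun x => ?_
    simp only [Pi.sub_apply]
    module

lemma integrable_inner_of_memLp {g h : Plane → Plane} (hg : MemLp g 2 σ) (hh : MemLp h 2 σ) :
    Integrable (fun x => inner ℝ (g x) (h x)) σ := by
  refine (hg.norm.integrable_mul hh.norm).mono
    (hg.aestronglyMeasurable.inner hh.aestronglyMeasurable) (Eventually.of_forall fun x => ?_)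
  simpa using abs_real_inner_le_norm (g x) (h x)

lemma IsSolution.comb {u₁ u₂ u : Plane → Plane} (a b : ℝ)
    (h₁ : IsSolution Ω σ lam mu Λ u₁) (h₂ : IsSolution Ω σ lam mu Λ u₂)
    (hu : u =ᵐ[volume.restrict Ω] fun x => a • u₁ x + b • u₂ x) :
    IsSolution Ω σ lam mu Λ u := by
  obtain ⟨G₁, g₁, w₁, t₁, e₁⟩ := h₁
  obtain ⟨G₂, g₂, w₂, t₂, e₂⟩ := h₂
  refine ⟨_, _, w₁.comb a b w₂ hu, IsTrace.comb a b w₁ w₂ t₁ t₂ hu, fun v H h wv tv => ?_⟩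
  have I₁ := (integrable_frob (lam := lam) (mu := mu) w₁.memLp_jacobian
    wv.memLp_jacobian).const_mul a
  have I₂ := (integrable_frob (lam := lam) (mu := mu) w₂.memLp_jacobian
    wv.memLp_jacobian).const_mul b
  have J₁ := (integrable_inner_of_memLp t₁.1 tv.1).const_mul a
  have J₂ := (integrable_inner_of_memLp t₂.1 tv.1).const_mul b
  simp only [frob_hooke_strain_comb, inner_add_left, real_inner_smul_left]
  rw [integral_add I₁ I₂, integral_add J₁ J₂, integral_const_mul, integral_const_mul,
    integral_const_mul, integral_const_mul, e₁ v H h wv tv, e₂ v H h wv tv]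
  ring

lemma isSolution_zero : IsSolution Ω σ lam mu Λ (fun _ => 0) := by
  refine ⟨fun _ => 0, fun _ => 0, ⟨MemLp.zero', fun _ _ => by simp, fun _ _ _ _ _ _ => by simp⟩,
    ⟨MemLp.zero', fun _ _ => 0, fun _ => contDiff_const, by simp, fun _ _ => by simp, by simp⟩,
    fun v H h _ _ => ?_⟩
  simp [frob, hooke, strain]

end helpers

/-- The eigenspace of the Steklov-Lamé problem for `Λ`: all its solutions (and so `0`), where
fields that agree almost everywhere in `Ω` are identified. -/
def eigenspace (Ω : Set Plane) (σ : Measure Plane) (lam mu Λ : ℝ) :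
    Submodule ℝ (Lp Plane 2 (volume.restrict Ω)) where
  carrier := {u | IsSolution Ω σ lam mu Λ u}
  zero_mem' := IsSolution.comb 0 0 isSolution_zero isSolution_zero
    ((Lp.coeFn_zero _ _ _).trans (Eventually.of_forall fun x => by simp))
  add_mem' {u v} hu hv := IsSolution.comb 1 1 hu hv
    ((Lp.coeFn_add u v).trans (Eventually.of_forall fun x => by simp))
  smul_mem' a u hu := IsSolution.comb a 0 hu hu
    ((Lp.coeFn_smul a u).trans (Eventually.of_forall fun x => by simp))

/-- `s 0 ≤ s 1 ≤ s 2 ≤ …` is the spectrum of the Steklov-Lamé problem, arranged in increasing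
order, every real number being repeated according to the dimension of its eigenspace. -/
structure IsSortedSpectrum (Ω : Set Plane) (σ : Measure Plane) (lam mu : ℝ) (s : ℕ → ℝ) :
    Prop where
  monotone : Monotone s
  tendsto_atTop : Tendsto s atTop atTop
  multiplicity : ∀ Λ : ℝ,
    Module.rank ℝ (eigenspace Ω σ lam mu Λ) = Cardinal.mk {k : ℕ // s k = Λ}

/-! ### The disk -/

/-- The arc length measure of the circle of centre `c` and radius `R`. -/
def circleMeasure (c : Plane) (R : ℝ) : Measure Plane :=
  ENNReal.ofReal R • Measure.map (fun θ : ℝ => c + !₂[R * Real.cos θ, R * Real.sin θ])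
    (volume.restrict (Set.Ioc (-Real.pi) Real.pi))

/-- The indices of the list of eigenvalues, one for every entry of the list counted with
multiplicity. -/
inductive DiskIndex : Type
  | one (k : Fin 3)
  | two
  | three (k : Fin 2)
  | four (n : ℕ) (hn : 2 ≤ n) (k : Fin 2)
  | five (n : ℕ) (hn : 2 ≤ n) (k : Fin 2)

/-- The list of eigenvalues of the disk of radius `R`. -/
def diskEigenvalue (lam mu R : ℝ) : DiskIndex → ℝ
  | .one _ => 0
  | .two => 2 * (lam + mu) / R
  | .three _ => 4 * mu * (lam + mu) / ((lam + 3 * mu) * R)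
  | .four n _ _ => 2 * mu * ((n : ℝ) - 1) / R
  | .five n _ _ => 2 * ((n : ℝ) + 1) * mu * (lam + mu) / ((lam + 3 * mu) * R)

/-- The eigenfunctions of the disk of radius `R`, in polar coordinates around its centre, with
components in the fixed Cartesian frame. -/
def polarMode (lam mu R r θ : ℝ) : DiskIndex → Plane
  | .one 0 => !₂[1, 0]
  | .one 1 => !₂[0, 1]
  | .one 2 => r • !₂[-Real.sin θ, Real.cos θ]
  | .two => r • !₂[Real.cos θ, Real.sin θ]
  | .three 0 =>
      !₂[2 * (R ^ 2 - r ^ 2) + (lam + 3 * mu) * r ^ 2 * Real.cos (2 * θ) / (lam + mu),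
        (lam + 3 * mu) * r ^ 2 * Real.sin (2 * θ) / (lam + mu)]
  | .three 1 =>
      !₂[(lam + 3 * mu) * r ^ 2 * Real.sin (2 * θ) / (lam + mu),
        2 * (R ^ 2 - r ^ 2) - (lam + 3 * mu) * r ^ 2 * Real.cos (2 * θ) / (lam + mu)]
  | .four n _ 0 =>
      r ^ (n - 1) • !₂[Real.cos (((n : ℝ) - 1) * θ), -Real.sin (((n : ℝ) - 1) * θ)]
  | .four n _ 1 =>
      r ^ (n - 1) • !₂[Real.sin (((n : ℝ) - 1) * θ), Real.cos (((n : ℝ) - 1) * θ)]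
  | .five n _ 0 =>
      (r ^ (n - 1) / ((lam + mu) * n)) •
        !₂[-(lam + mu) * ((n : ℝ) + 1) * (r ^ 2 - R ^ 2) * Real.cos (((n : ℝ) - 1) * θ)
            + (lam + 3 * mu) * r ^ 2 * Real.cos (((n : ℝ) + 1) * θ),
          (lam + mu) * ((n : ℝ) + 1) * (r ^ 2 - R ^ 2) * Real.sin (((n : ℝ) - 1) * θ)
            + (lam + 3 * mu) * r ^ 2 * Real.sin (((n : ℝ) + 1) * θ)]
  | .five n _ 1 =>
      (r ^ (n - 1) / ((lam + mu) * n)) •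
        !₂[(lam + mu) * ((n : ℝ) + 1) * (r ^ 2 - R ^ 2) * Real.sin (((n : ℝ) - 1) * θ)
            - (lam + 3 * mu) * r ^ 2 * Real.sin (((n : ℝ) + 1) * θ),
          (lam + mu) * ((n : ℝ) + 1) * (r ^ 2 - R ^ 2) * Real.cos (((n : ℝ) - 1) * θ)
            + (lam + 3 * mu) * r ^ 2 * Real.cos (((n : ℝ) + 1) * θ)]

/-- The eigenfunctions of the disk of centre `c` and radius `R`, as fields on the plane. -/
def diskMode (lam mu : ℝ) (c : Plane) (R : ℝ) (i : DiskIndex) (x : Plane) : Plane :=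
  polarMode lam mu R ‖x - c‖ (Complex.arg ⟨(x - c) 0, (x - c) 1⟩) i

end SteklovLame

end

/-!
With the Wirtinger derivatives `a = ∂_z u` and `b = ∂_z̄ u` of a displacement `u`, read as a
function of `z = x - c`, the elastic energy density is `4 ((λ + μ) (Re a)² + μ |b|²)`, and the stress is
encoded by the real function `(λ + μ) Re a` and the complex function `μ b`. In this notation the
listed functions are `α z̄^m`, `α z`, and fields given by the Kolosov-Muskhelishvili formula
(`antiholMode`, `linearMode`, `kolosovMode`), and the equations in the disk and on its boundary are
polynomial identities (`isClassicalMode_modeC`). On the boundary circle each of these fields is a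
monomial `w e^{ikθ}`, and for every integer `k` there are exactly two of them, one with real and one
with imaginary `w ≠ 0`. Their traces are therefore orthogonal (`integral_inner_modes_of_ne`) and
complete in `L²` of the circle (`ae_eq_zero_of_orthogonal_modes`).

The divergence theorem on the disk is proved in polar coordinates (`integral_ball_divergence`). It
gives Green's formula for smooth test fields and, by density, for all test fields of `H¹`
(`IsClassicalMode.weak_form`), so that the modes are weak solutions.

Conversely, let `u` be a weak solution for `Λ`. Testing its equation with a mode, and the equation
of the mode with `u`, shows that the trace of `u` is orthogonal to the modes for all eigenvalues
other than `Λ`. By completeness it is the trace of a linear combination of the finitely many modes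
for `Λ`. The difference is a solution of zero trace, so that its energy, and hence its strain,
vanishes. Since the trace is zero, integration by parts against an arbitrary smooth function `ψ`
has no boundary term, and `∂_j u_j = 0` yields `∫ u_j ∂_j ψ = 0`; as every test function is on the
disk of the form `∂_j ψ`, the difference is zero (`ae_eq_zero_of_trace_zero`). This is
`IsSolution.exists_ae_eq_sum`; no Korn inequality is needed.

Linear independence follows from the orthogonality on the boundary. The eigenvalues have finite
sublevel sets, so that they can be enumerated in increasing order (`exists_equiv_monotone`).
-/

noncomputable section

namespace SteklovLame

open ComplexConjugate

/-! ### Wirtinger derivatives and the divergence theorem on a disk -/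

/-- The real-linear map `h ↦ a h + b h̄` of the complex plane. A function with this derivative at
a point has there the Wirtinger derivatives `a = ∂_z` and `b = ∂_z̄`. -/
def wirtinger (a b : ℂ) : ℂ →L[ℝ] ℂ :=
  a • ContinuousLinearMap.id ℝ ℂ + b • (Complex.conjCLE : ℂ →L[ℝ] ℂ)

@[simp] lemma wirtinger_apply (a b h : ℂ) : wirtinger a b h = a * h + b * conj h := by
  simp [wirtinger]

lemma integral_ball_eq_polar {R : ℝ} (hR : 0 < R) {f : ℂ → ℝ} (hf : Continuous f) :
    ∫ z in Metric.ball (0 : ℂ) R, f z =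
      ∫ r in (0 : ℝ)..R, ∫ θ in (-Real.pi)..Real.pi,
        r * f (r * Complex.exp (θ * Complex.I)) := by
  have hsub : ∀ p : ℝ × ℝ, Complex.polarCoord.symm p = p.1 * Complex.exp (p.2 * Complex.I) :=
    fun p => by rw [Complex.polarCoord_symm_apply, Complex.exp_mul_I]; simp
  have hcont : Continuous fun p : ℝ × ℝ => p.1 * f (p.1 * Complex.exp (p.2 * Complex.I)) := by
    fun_prop
  rw [← integral_indicator Metric.isOpen_ball.measurableSet,
    ← Complex.integral_comp_polarCoord_symm, polarCoord_target]
  have h1 : ∀ p ∈ Set.Ioi (0 : ℝ) ×ˢ Set.Ioo (-Real.pi) Real.pi,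
      p.1 • (Metric.ball (0 : ℂ) R).indicator f (Complex.polarCoord.symm p) =
        (Set.Iio R ×ˢ Set.univ).indicator
          (fun p : ℝ × ℝ => p.1 * f (p.1 * Complex.exp (p.2 * Complex.I))) p := by
    rintro ⟨r, θ⟩ ⟨hr, -⟩
    have hr : 0 < r := hr
    rw [hsub, smul_eq_mul]
    by_cases h : r < R
    · rw [Set.indicator_of_mem (by simpa [abs_of_pos hr] using h),
        Set.indicator_of_mem (by simpa using h)]
    · rw [Set.indicator_of_notMem (by simpa [abs_of_pos hr] using h),
        Set.indicator_of_notMem (by simpa using h), mul_zero]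
  rw [setIntegral_congr_fun (measurableSet_Ioi.prod measurableSet_Ioo) h1,
    setIntegral_indicator (measurableSet_Iio.prod MeasurableSet.univ), Set.prod_inter_prod,
    Set.inter_univ, Set.Ioi_inter_Iio, Measure.volume_eq_prod,
    setIntegral_prod _ ?_, intervalIntegral.integral_of_le hR.le, integral_Ioc_eq_integral_Ioo]
  · refine setIntegral_congr_fun measurableSet_Ioo fun r _ => ?_
    simp only
    rw [intervalIntegral.integral_of_le (by linarith [Real.pi_pos]), integral_Ioc_eq_integral_Ioo]
  · exact ((hcont.continuousOn).integrableOn_compact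
      (isCompact_Icc.prod isCompact_Icc)).mono_set
        (Set.prod_mono Set.Ioo_subset_Icc_self Set.Ioo_subset_Icc_self)

/-- The divergence theorem on the disk: `2 Re ∂_z F` is the divergence of the vector field `F`. -/
lemma integral_ball_divergence {R : ℝ} (hR : 0 < R) {F A B : ℂ → ℂ}
    (hF : ∀ z, HasFDerivAt F (wirtinger (A z) (B z)) z) (hA : Continuous A) :
    ∫ z in Metric.ball (0 : ℂ) R, 2 * (A z).re =
      R * ∫ θ in Set.Ioc (-Real.pi) Real.pi,
        (F (R * Complex.exp (θ * Complex.I)) * conj (Complex.exp (θ * Complex.I))).re := by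
  have hFc : Continuous F := continuous_iff_continuousAt.2 fun z => (hF z).continuousAt
  rw [integral_ball_eq_polar hR (f := fun z => 2 * (A z).re) (by fun_prop)]
  -- `r F_r` and `F_θ`, whose `∂_r` and `∂_θ` add up to `r` times the divergence
  let E : ℝ → ℂ := fun θ => Complex.exp (θ * Complex.I)
  let f : ℝ × ℝ → ℝ := fun p => p.1 * (F (p.1 * E p.2) * conj (E p.2)).re
  let g : ℝ × ℝ → ℝ := fun p => (F (p.1 * E p.2) * conj (E p.2)).im
  have hE : ∀ θ, HasDerivAt E (E θ * Complex.I) θ := fun θ => by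
    have := ((Complex.ofRealCLM.hasDerivAt (x := θ)).mul_const Complex.I).cexp
    simpa [E] using this
  have hEE : ∀ θ, E θ * conj (E θ) = 1 := fun θ => by
    rw [Complex.mul_conj, Complex.normSq_eq_norm_sq, Complex.norm_exp_ofReal_mul_I]; simp
  have hEc : Continuous E := continuous_iff_continuousAt.2 fun z => (hE z).continuousAt
  have hm : ∀ p : ℝ × ℝ, HasFDerivAt (fun p : ℝ × ℝ => (p.1 : ℂ) * E p.2) _ p := fun p =>
    ((Complex.ofRealCLM.hasFDerivAt (x := p.1)).comp p hasFDerivAt_fst).mul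
      ((hE p.2).hasFDerivAt.comp p hasFDerivAt_snd)
  have hN : ∀ p : ℝ × ℝ,
      HasFDerivAt (fun p : ℝ × ℝ => F (p.1 * E p.2) * conj (E p.2)) _ p := fun p =>
    ((hF (p.1 * E p.2)).comp p (hm p)).mul ((Complex.conjCLE : ℂ →L[ℝ] ℂ).hasFDerivAt.comp p
      ((hE p.2).hasFDerivAt.comp p hasFDerivAt_snd))
  obtain ⟨f', hf, hf1⟩ : ∃ f' : ℝ × ℝ → ℝ × ℝ →L[ℝ] ℝ, (∀ p, HasFDerivAt f (f' p) p) ∧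
      ∀ p, f' p (1, 0) = (F (p.1 * E p.2) * conj (E p.2)).re +
        p.1 * ((A (p.1 * E p.2) * E p.2 + B (p.1 * E p.2) * conj (E p.2)) * conj (E p.2)).re := by
    refine ⟨_, fun p => (hasFDerivAt_fst (p := p)).mul
      ((Complex.reCLM.hasFDerivAt).comp p (hN p)), fun p => ?_⟩
    simp
    ring
  obtain ⟨g', hg, hg1⟩ : ∃ g' : ℝ × ℝ → ℝ × ℝ →L[ℝ] ℝ, (∀ p, HasFDerivAt g (g' p) p) ∧
      ∀ p, g' p (0, 1) = ((A (p.1 * E p.2) * (p.1 * (E p.2 * Complex.I)) +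
        B (p.1 * E p.2) * conj (p.1 * (E p.2 * Complex.I))) * conj (E p.2) +
        F (p.1 * E p.2) * conj (E p.2 * Complex.I)).im := by
    refine ⟨_, fun p => (Complex.imCLM.hasFDerivAt).comp p (hN p), fun p => ?_⟩
    simp
    ring
  have hdiv : ∀ p : ℝ × ℝ, f' p (1, 0) + g' p (0, 1) = p.1 * (2 * (A (p.1 * E p.2)).re) := by
    intro p
    have h1 : (A (p.1 * E p.2)).re = (A (p.1 * E p.2) * (E p.2 * conj (E p.2))).re := by
      rw [hEE, mul_one]
    rw [hf1, hg1, h1]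
    simp
    ring
  have hEnd : ∀ r, g (r, Real.pi) = g (r, -Real.pi) := fun r => by simp [g, E]
  have key := integral2_divergence_prod_of_hasFDerivAt f g f' g' 0 (-Real.pi) R Real.pi
    (fun p _ => (hf p).continuousAt.continuousWithinAt)
    (fun p _ => (hg p).continuousAt.continuousWithinAt)
    (fun p _ => hf p) (fun p _ => hg p) (by
      simp only [hdiv]
      exact Continuous.continuousOn (by fun_prop) |>.integrableOn_compact
        (isCompact_uIcc.prod isCompact_uIcc))
  simp only [hdiv, hEnd] at key
  rw [key, ← intervalIntegral.integral_of_le (by linarith [Real.pi_pos]),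
    ← intervalIntegral.integral_const_mul]
  simp [f, E]

/-! ### Identification of the plane with `ℂ` -/

/-- The isometry `z ↦ (Re z, Im z)` of `ℂ` with the plane. -/
def ofComplex : ℂ ≃ₗᵢ[ℝ] Plane := Complex.orthonormalBasisOneI.repr

lemma ofComplex_eq (z : ℂ) : ofComplex z = !₂[z.re, z.im] := by
  ext i
  simp [ofComplex]

@[simp] lemma ofComplex_zero_apply (z : ℂ) : ofComplex z 0 = z.re := by simp [ofComplex_eq]

@[simp] lemma ofComplex_one_apply (z : ℂ) : ofComplex z 1 = z.im := by simp [ofComplex_eq]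

@[simp] lemma ofComplex_symm_re (x : Plane) : (ofComplex.symm x).re = x 0 := by
  simp [ofComplex]

@[simp] lemma ofComplex_symm_im (x : Plane) : (ofComplex.symm x).im = x 1 := by
  simp [ofComplex]

lemma ofComplex_one : ofComplex 1 = EuclideanSpace.single 0 1 := by
  ext i; fin_cases i <;> simp

lemma ofComplex_I : ofComplex Complex.I = EuclideanSpace.single 1 1 := by
  ext i; fin_cases i <;> simp

lemma inner_ofComplex (z w : ℂ) : inner ℝ (ofComplex z) (ofComplex w) = (z * conj w).re := by
  rw [ofComplex.inner_map_map, Complex.inner, mul_comm, ← Complex.conj_re]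
  simp [mul_comm]

lemma setIntegral_ball_eq (c : Plane) (R : ℝ) (f : Plane → ℝ) :
    ∫ x in Metric.ball c R, f x = ∫ z in Metric.ball (0 : ℂ) R, f (c + ofComplex z) := by
  have hmp : MeasurePreserving (fun z : ℂ => c + ofComplex z) volume volume :=
    (measurePreserving_add_left volume c).comp ofComplex.measurePreserving
  have hemb : MeasurableEmbedding (fun z : ℂ => c + ofComplex z) :=
    (measurableEmbedding_addLeft c).comp ofComplex.toHomeomorph.measurableEmbedding
  rw [← hmp.setIntegral_preimage_emb hemb]
  congr 2
  ext z
  simp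

/-- The point `c + R e^{iθ}` of the circle. -/
def circlePoint (c : Plane) (R θ : ℝ) : Plane := c + ofComplex (R * Complex.exp (θ * Complex.I))

lemma continuous_circlePoint (c : Plane) (R : ℝ) : Continuous (circlePoint c R) := by
  unfold circlePoint
  fun_prop

lemma circleMeasure_eq (c : Plane) (R : ℝ) : circleMeasure c R = ENNReal.ofReal R •
    Measure.map (circlePoint c R) (volume.restrict (Set.Ioc (-Real.pi) Real.pi)) := by
  unfold circleMeasure
  congr 2
  ext θ i
  rw [circlePoint, ofComplex_eq]
  simp [Complex.exp_re, Complex.exp_im]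

instance (c : Plane) (R : ℝ) : IsFiniteMeasure (circleMeasure c R) := by
  rw [circleMeasure_eq]
  have : IsFiniteMeasure (Measure.map (circlePoint c R)
    (volume.restrict (Set.Ioc (-Real.pi) Real.pi))) := Measure.isFiniteMeasure_map _ _
  exact Measure.smul_finite _ ENNReal.ofReal_ne_top

lemma aestronglyMeasurable_comp_circlePoint {F : Type*} [NormedAddCommGroup F] {c : Plane} {R : ℝ}
    (hR : 0 < R) {f : Plane → F} (hf : AEStronglyMeasurable f (circleMeasure c R)) :
    AEStronglyMeasurable f (Measure.map (circlePoint c R)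
      (volume.restrict (Set.Ioc (-Real.pi) Real.pi))) := by
  rw [circleMeasure_eq] at hf
  refine hf.mono_ac (Measure.AbsolutelyContinuous.mk fun s _ h => ?_)
  simpa [hR.not_ge] using h

lemma integral_circleMeasure {c : Plane} {R : ℝ} (hR : 0 < R) {f : Plane → ℝ}
    (hf : AEStronglyMeasurable f (circleMeasure c R)) :
    ∫ x, f x ∂circleMeasure c R =
      R * ∫ θ in Set.Ioc (-Real.pi) Real.pi, f (circlePoint c R θ) := by
  have h := aestronglyMeasurable_comp_circlePoint hR hf
  rw [circleMeasure_eq, integral_smul_measure,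
    integral_map (continuous_circlePoint c R).aemeasurable h, ENNReal.toReal_ofReal hR.le,
    smul_eq_mul]

lemma eLpNorm_circleMeasure {F : Type*} [NormedAddCommGroup F] {c : Plane} {R : ℝ} (hR : 0 < R)
    {f : Plane → F} (hf : AEStronglyMeasurable f (circleMeasure c R)) :
    eLpNorm f 2 (circleMeasure c R) = ENNReal.ofReal R ^ (1 / 2 : ℝ) *
      eLpNorm (f ∘ circlePoint c R) 2 (volume.restrict (Set.Ioc (-Real.pi) Real.pi)) := by
  have h := aestronglyMeasurable_comp_circlePoint hR hf
  rw [circleMeasure_eq, eLpNorm_smul_measure_of_ne_top (by simp),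
    eLpNorm_map_measure h (continuous_circlePoint c R).aemeasurable]
  simp

/-! ### Wirtinger derivatives of displacements -/

/-- Half of `M₀₀ + M₁₁ + i (M₁₀ - M₀₁)`: the Wirtinger derivative `∂_z` of a displacement with
Jacobian `M`. -/
def matDz (M : Matrix (Fin 2) (Fin 2) ℝ) : ℂ := ⟨(M 0 0 + M 1 1) / 2, (M 1 0 - M 0 1) / 2⟩

/-- Half of `M₀₀ - M₁₁ + i (M₁₀ + M₀₁)`: the Wirtinger derivative `∂_z̄` of a displacement with
Jacobian `M`. -/
def matDzbar (M : Matrix (Fin 2) (Fin 2) ℝ) : ℂ := ⟨(M 0 0 - M 1 1) / 2, (M 1 0 + M 0 1) / 2⟩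

/-- The elastic energy density, in terms of Wirtinger derivatives. -/
lemma frob_hooke_strain (lam mu : ℝ) (M N : Matrix (Fin 2) (Fin 2) ℝ) :
    frob (hooke lam mu (strain M)) (strain N) =
      4 * ((lam + mu) * (matDz M).re * (matDz N).re +
        mu * (matDzbar M * conj (matDzbar N)).re) := by
  simp [frob, hooke, strain, Fin.sum_univ_two, Matrix.trace, Matrix.one_apply, matDz, matDzbar]
  ring

/-- The Jacobian matrix of a displacement. -/
def jac (v : Plane → Plane) (x : Plane) : Matrix (Fin 2) (Fin 2) ℝ :=
  fun i j => fderiv ℝ v x (EuclideanSpace.single j 1) i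

/-- A displacement, read as a function of the complex variable `z = x - c`. -/
def complexField (c : Plane) (v : Plane → Plane) (z : ℂ) : ℂ := ofComplex.symm (v (c + ofComplex z))

/-- The displacement of the plane given by a function of the complex variable `z = x - c`. -/
def planeField (c : Plane) (U : ℂ → ℂ) (x : Plane) : Plane := ofComplex (U (ofComplex.symm (x - c)))

@[simp] lemma complexField_planeField (c : Plane) (U : ℂ → ℂ) :
    complexField c (planeField c U) = U := by
  ext z; simp [complexField, planeField]

lemma eq_wirtinger (T : ℂ →L[ℝ] ℂ) :
    T = wirtinger ((T 1 - Complex.I * T Complex.I) / 2) ((T 1 + Complex.I * T Complex.I) / 2) := by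
  ext z
  have hz : T z = z.re * T 1 + z.im * T Complex.I := by
    conv_lhs => rw [show z = z.re • (1 : ℂ) + z.im • Complex.I by simp [Complex.re_add_im]]
    rw [map_add, map_smul, map_smul]
    simp
  rw [hz, wirtinger_apply]
  apply Complex.ext <;> simp <;> ring

lemma hasFDerivAt_complexField (c : Plane) {v : Plane → Plane} {z : ℂ}
    (hv : DifferentiableAt ℝ v (c + ofComplex z)) :
    HasFDerivAt (complexField c v) (wirtinger (matDz (jac v (c + ofComplex z)))
      (matDzbar (jac v (c + ofComplex z)))) z := by
  have h1 : HasFDerivAt (fun z : ℂ => c + ofComplex z)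
      (ofComplex.toContinuousLinearEquiv : ℂ →L[ℝ] Plane) z :=
    (ofComplex.toContinuousLinearEquiv.hasFDerivAt).const_add c
  have h2 := (ofComplex.symm.toContinuousLinearEquiv.hasFDerivAt).comp z
    (hv.hasFDerivAt.comp z h1)
  refine h2.congr_fderiv ?_
  refine (eq_wirtinger _).trans ?_
  congr 1 <;> apply Complex.ext <;> simp [ofComplex_one, ofComplex_I, jac, matDz, matDzbar,
    sub_eq_add_neg]

lemma wirtinger_injective {a b a' b' : ℂ} (h : wirtinger a b = wirtinger a' b') :
    a = a' ∧ b = b' := by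
  have h1 := congrArg (fun T : ℂ →L[ℝ] ℂ => T 1) h
  have h2 := congrArg (fun T : ℂ →L[ℝ] ℂ => T Complex.I) h
  simp only [wirtinger_apply, map_one, Complex.conj_I] at h1 h2
  have h3 : Complex.I * (a - b) = Complex.I * (a' - b') := by linear_combination h2
  have h4 := mul_left_cancel₀ Complex.I_ne_zero h3
  constructor
  · linear_combination (h1 + h4) / 2
  · linear_combination (h1 - h4) / 2

lemma contDiff_planeField {c : Plane} {U : ℂ → ℂ} (hU : ContDiff ℝ ∞ U) :
    ContDiff ℝ ∞ (planeField c U) :=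
  ofComplex.toContinuousLinearEquiv.contDiff.comp (hU.comp
    (ofComplex.symm.toContinuousLinearEquiv.contDiff.comp (contDiff_id.sub contDiff_const)))

lemma matDz_jac_planeField {c : Plane} {U : ℂ → ℂ} (hU : ContDiff ℝ ∞ U) {a b : ℂ} {z : ℂ}
    (h : HasFDerivAt U (wirtinger a b) z) :
    matDz (jac (planeField c U) (c + ofComplex z)) = a ∧
      matDzbar (jac (planeField c U) (c + ofComplex z)) = b := by
  have h' := hasFDerivAt_complexField c (z := z)
    ((contDiff_planeField (c := c) hU).differentiable (by simp) _)
  rw [complexField_planeField] at h'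
  exact wirtinger_injective (h'.unique h)

lemma continuous_jac {v : Plane → Plane} (hv : ContDiff ℝ 1 v) (i j : Fin 2) :
    Continuous fun x => jac v x i j :=
  (EuclideanSpace.proj (𝕜 := ℝ) i).continuous.comp
    ((hv.continuous_fderiv (by simp)).clm_apply continuous_const)

lemma continuous_matDz_jac {v : Plane → Plane} (hv : ContDiff ℝ 1 v) :
    Continuous fun x => matDz (jac v x) := by
  have h00 := continuous_jac hv 0 0
  have h01 := continuous_jac hv 0 1
  have h10 := continuous_jac hv 1 0
  have h11 := continuous_jac hv 1 1
  exact Complex.equivRealProdCLM.symm.continuous.comp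
    (((h00.add h11).div_const 2).prodMk ((h10.sub h01).div_const 2))

lemma continuous_matDzbar_jac {v : Plane → Plane} (hv : ContDiff ℝ 1 v) :
    Continuous fun x => matDzbar (jac v x) := by
  have h00 := continuous_jac hv 0 0
  have h01 := continuous_jac hv 0 1
  have h10 := continuous_jac hv 1 0
  have h11 := continuous_jac hv 1 1
  exact Complex.equivRealProdCLM.symm.continuous.comp
    (((h00.sub h11).div_const 2).prodMk ((h10.add h01).div_const 2))

/-- The divergence theorem on a disk of the plane. -/
lemma integral_ball_fderiv {c : Plane} {R : ℝ} (hR : 0 < R) {f : Plane → ℝ} (hf : ContDiff ℝ 1 f)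
    (j : Fin 2) :
    ∫ x in Metric.ball c R, fderiv ℝ f x (EuclideanSpace.single j 1) =
      ∫ x, f x * ((x - c) j / R) ∂circleMeasure c R := by
  -- the field `f e_j`
  let v : Plane → Plane := fun x => f x • EuclideanSpace.single j 1
  have hv : ContDiff ℝ 1 v := hf.smul contDiff_const
  have hjac : ∀ x, 2 * (matDz (jac v x)).re = fderiv ℝ f x (EuclideanSpace.single j 1) := by
    intro x
    have h : HasFDerivAt v ((fderiv ℝ f x).smulRight (EuclideanSpace.single j (1 : ℝ))) x :=
      ((hf.differentiable (by simp)) x).hasFDerivAt.smul_const _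
    fin_cases j <;> simp [matDz, jac, h.fderiv] <;> ring
  have key := integral_ball_divergence hR (F := complexField c v) (fun z =>
    hasFDerivAt_complexField c (hv.differentiable (by simp) _))
    (by exact (continuous_matDz_jac hv).comp (by fun_prop))
  simp only [hjac] at key
  rw [setIntegral_ball_eq, key, integral_circleMeasure hR]
  · congr 1
    refine integral_congr_ae (Eventually.of_forall fun θ => ?_)
    have hR' := hR.ne'
    fin_cases j <;> simp [complexField, v, circlePoint] <;> field_simp <;> simp
  · refine Continuous.aestronglyMeasurable ?_
    have := hf.continuous
    fun_prop

/-! ### Classical solutions -/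

/-- `U` is, as a function of `z = x - c`, a smooth classical solution of the Steklov-Lamé problem
on the disk of radius `R`, for the value `Λ`. With `a = ∂_z U` and `b = ∂_z̄ U`, the stress `S` is
encoded by `D = (λ + μ) Re a = (S₀₀ + S₁₁) / 4` and `Q = μ b = (S₀₀ - S₁₁ + 2 i S₀₁) / 4`. The
equation `div S = 0` is `∂_z̄ D + ∂_z Q = 0`, where `d = ∂_z D` and `q = ∂_z Q`, and the boundary
traction at `z` is `2 (D z + Q z̄) / R`. -/
structure IsClassicalMode (lam mu R Λ : ℝ) (U : ℂ → ℂ) : Prop where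
  contDiff : ContDiff ℝ ∞ U
  equations : ∃ a b d q : ℂ → ℂ,
    (∀ z, HasFDerivAt U (wirtinger (a z) (b z)) z) ∧
    (∀ z, HasFDerivAt (fun z => (((lam + mu) * (a z).re : ℝ) : ℂ))
      (wirtinger (d z) (conj (d z))) z) ∧
    (∀ z, ∃ q', HasFDerivAt (fun z => (mu : ℂ) * b z) (wirtinger (q z) q') z) ∧
    Continuous d ∧ Continuous q ∧
    (∀ z, conj (d z) + q z = 0) ∧
    ∀ z, ‖z‖ = R → 2 * (((lam + mu) * (a z).re : ℝ) : ℂ) * z + 2 * (mu * b z) * conj z =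
      Λ * R * U z

lemma hasFDerivAt_wirtinger_const (a z : ℂ) :
    HasFDerivAt (fun _ : ℂ => a) (wirtinger 0 0) z :=
  (hasFDerivAt_const a z).congr_fderiv (by ext; simp)

lemma hasFDerivAt_wirtinger_mul {F G : ℂ → ℂ} {a b a' b' z : ℂ}
    (hF : HasFDerivAt F (wirtinger a b) z) (hG : HasFDerivAt G (wirtinger a' b') z) :
    HasFDerivAt (fun z => F z * G z)
      (wirtinger (a * G z + F z * a') (b * G z + F z * b')) z := by
  refine (hF.mul hG).congr_fderiv ?_
  ext h
  simp
  ring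

lemma hasFDerivAt_wirtinger_conj {F : ℂ → ℂ} {a b z : ℂ} (hF : HasFDerivAt F (wirtinger a b) z) :
    HasFDerivAt (fun z => conj (F z)) (wirtinger (conj b) (conj a)) z := by
  refine ((Complex.conjCLE : ℂ →L[ℝ] ℂ).hasFDerivAt.comp z hF).congr_fderiv ?_
  ext h
  simp
  ring

lemma hasFDerivAt_wirtinger_add {F G : ℂ → ℂ} {a b a' b' z : ℂ}
    (hF : HasFDerivAt F (wirtinger a b) z) (hG : HasFDerivAt G (wirtinger a' b') z) :
    HasFDerivAt (fun z => F z + G z) (wirtinger (a + a') (b + b')) z := by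
  refine (hF.add hG).congr_fderiv ?_
  ext h
  simp
  ring

/-- Green's formula for a classical mode, tested with smooth displacements. -/
lemma IsClassicalMode.weak_form_smooth {lam mu R Λ : ℝ} {U : ℂ → ℂ}
    (hU : IsClassicalMode lam mu R Λ U) (hR : 0 < R) (c : Plane) {v : Plane → Plane}
    (hv : ContDiff ℝ ∞ v) :
    ∫ x in Metric.ball c R,
        frob (hooke lam mu (strain (jac (planeField c U) x))) (strain (jac v x)) =
      Λ * ∫ x, inner ℝ (planeField c U x) (v x) ∂circleMeasure c R := by
  obtain ⟨a, b, d, q, ha, hD, hQ, hd, hq, heq, hbd⟩ := hU.equations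
  choose q' hQ using hQ
  have hv1 : ContDiff ℝ 1 v := hv.of_le (by exact_mod_cast le_top)
  set V := complexField c v with hV
  have hVd : ∀ z, HasFDerivAt V (wirtinger (matDz (jac v (c + ofComplex z)))
      (matDzbar (jac v (c + ofComplex z)))) z := fun z =>
    hasFDerivAt_complexField c (hv.differentiable (by simp) _)
  have hcont : ∀ {F : ℂ → ℂ} {a b : ℂ → ℂ}, (∀ z, HasFDerivAt F (wirtinger (a z) (b z)) z) →
      Continuous F := fun h => continuous_iff_continuousAt.2 fun z => (h z).continuousAt
  have hDc := hcont hD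
  have hQc := hcont hQ
  have hVc := hcont hVd
  have hA : Continuous fun z => matDz (jac v (c + ofComplex z)) :=
    (continuous_matDz_jac hv1).comp (by fun_prop)
  have hB : Continuous fun z => matDzbar (jac v (c + ofComplex z)) :=
    (continuous_matDzbar_jac hv1).comp (by fun_prop)
  -- the divergence theorem is applied to `S v = 2 D V + 2 Q V̄`
  have hF := fun z => hasFDerivAt_wirtinger_mul (hasFDerivAt_wirtinger_const 2 z)
    (hasFDerivAt_wirtinger_add
    (hasFDerivAt_wirtinger_mul (hD z) (hVd z))
    (hasFDerivAt_wirtinger_mul (hQ z) (hasFDerivAt_wirtinger_conj (hVd z))))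
  have key := integral_ball_divergence hR hF (by fun_prop)
  rw [setIntegral_ball_eq, integral_circleMeasure hR]
  · have e1 : ∀ z, frob (hooke lam mu (strain (jac (planeField c U) (c + ofComplex z))))
        (strain (jac v (c + ofComplex z))) = _ := fun z => by
      rw [frob_hooke_strain, (matDz_jac_planeField hU.contDiff (ha z)).1,
        (matDz_jac_planeField hU.contDiff (ha z)).2]
    simp only [e1]
    rw [← mul_assoc, mul_comm Λ, mul_assoc, ← integral_const_mul]
    refine (integral_congr_ae (Eventually.of_forall fun z => ?_)).trans (key.trans ?_)
    · have h3 : q z = - conj (d z) := eq_neg_of_add_eq_zero_right (heq z)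
      simp [h3]
      ring
    · congr 1
      refine integral_congr_ae (Eventually.of_forall fun θ => ?_)
      have hz : ‖(R : ℂ) * Complex.exp (θ * Complex.I)‖ = R := by
        rw [norm_mul, Complex.norm_exp_ofReal_mul_I, Complex.norm_of_nonneg hR.le, mul_one]
      have h4 := hbd _ hz
      have hE : Complex.exp (θ * Complex.I) * conj (Complex.exp (θ * Complex.I)) = 1 := by
        rw [Complex.mul_conj, Complex.normSq_eq_norm_sq, Complex.norm_exp_ofReal_mul_I]; simp
      have h5 : v (circlePoint c R θ) = ofComplex (V (R * Complex.exp (θ * Complex.I))) := by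
        simp [hV, complexField, circlePoint]
      have h6 : planeField c U (circlePoint c R θ) =
          ofComplex (U (R * Complex.exp (θ * Complex.I))) := by
        simp [planeField, circlePoint]
      simp only [h5, h6, inner_ofComplex]
      generalize Complex.exp (θ * Complex.I) = e at *
      generalize V (R * e) = W at *
      have h7 : 2 * (((lam + mu) * (a (R * e)).re : ℝ) : ℂ) * e + 2 * (mu * b (R * e)) * conj e =
          Λ * U (R * e) := by
        refine mul_left_cancel₀ (Complex.ofReal_ne_zero.2 hR.ne') ?_
        simp only [map_mul, Complex.conj_ofReal] at h4
        linear_combination h4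
      have h8 : Λ * (U (R * e) * conj W).re = ((Λ * U (R * e)) * conj W).re := by
        rw [mul_assoc, Complex.re_ofReal_mul]
      rw [h8, ← h7]
      simp
      ring
  · have := (contDiff_planeField (c := c) hU.contDiff).continuous
    exact (this.inner hv.continuous).aestronglyMeasurable

/-! ### Fields in `H¹` of the disk and their traces -/

lemma memLp_ball_of_continuous {F : Type*} [NormedAddCommGroup F] [SecondCountableTopology F]
    {f : Plane → F} (hf : Continuous f) (c : Plane) (R : ℝ) :
    MemLp f 2 (volume.restrict (Metric.ball c R)) := by
  obtain ⟨C, hC⟩ := (isCompact_closedBall c R).exists_bound_of_continuousOn hf.continuousOn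
  have : IsFiniteMeasure (volume.restrict (Metric.ball c R)) :=
    ⟨by rw [Measure.restrict_apply_univ]; exact measure_ball_lt_top⟩
  exact MemLp.of_bound hf.aestronglyMeasurable C
    ((ae_restrict_mem measurableSet_ball).mono fun x hx => hC x (Metric.ball_subset_closedBall hx))

lemma norm_circlePoint_sub {c : Plane} {R : ℝ} (hR : 0 < R) (θ : ℝ) :
    ‖circlePoint c R θ - c‖ = R := by
  rw [circlePoint, add_sub_cancel_left, LinearIsometryEquiv.norm_map, norm_mul,
    Complex.norm_exp_ofReal_mul_I, Complex.norm_of_nonneg hR.le, mul_one]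

lemma ae_circleMeasure_mem_sphere {c : Plane} {R : ℝ} (hR : 0 < R) :
    ∀ᵐ x ∂circleMeasure c R, x ∈ Metric.sphere c R := by
  rw [circleMeasure_eq]
  refine Measure.ae_smul_measure ?_ _
  refine (ae_map_iff (continuous_circlePoint c R).aemeasurable
    Metric.isClosed_sphere.measurableSet).2 ?_
  exact Eventually.of_forall fun θ => by
    exact mem_sphere_iff_norm.2 (norm_circlePoint_sub hR θ)

lemma memLp_circle_of_continuous {F : Type*} [NormedAddCommGroup F] [SecondCountableTopology F]
    {f : Plane → F} (hf : Continuous f) (c : Plane) {R : ℝ} (hR : 0 < R) :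
    MemLp f 2 (circleMeasure c R) := by
  obtain ⟨C, hC⟩ := (isCompact_closedBall c R).exists_bound_of_continuousOn hf.continuousOn
  exact MemLp.of_bound hf.aestronglyMeasurable C
    ((ae_circleMeasure_mem_sphere hR).mono fun x hx => hC x (Metric.sphere_subset_closedBall hx))

/-- Convergence in `L²` implies convergence of the integrals against a function of `L²`. -/
lemma tendsto_integral_mul_of_eLpNorm {ν : Measure Plane} {f g : Plane → ℝ} {p : ℕ → Plane → ℝ}
    (hf : MemLp f 2 ν) (hg : MemLp g 2 ν) (hp : ∀ k, MemLp (p k) 2 ν)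
    (h : Tendsto (fun k => eLpNorm (fun x => p k x - g x) 2 ν) atTop (𝓝 0)) :
    Tendsto (fun k => ∫ x, f x * p k x ∂ν) atTop (𝓝 (∫ x, f x * g x ∂ν)) := by
  refine tendsto_integral_of_L1' _ (hf.integrable_mul hg).aestronglyMeasurable
    (Eventually.of_forall fun k => hf.integrable_mul (hp k)) ?_
  have hlim : Tendsto (fun k => eLpNorm f 2 ν * eLpNorm (fun x => p k x - g x) 2 ν)
      atTop (𝓝 0) := by
    simpa using ENNReal.Tendsto.const_mul h (Or.inr hf.2.ne)
  refine tendsto_of_tendsto_of_tendsto_of_le_of_le tendsto_const_nhds hlim (fun _ => bot_le)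
    fun k => ?_
  have e : (fun x => f x * p k x) - f * g = f • (fun x => p k x - g x) := by
    ext x; simp [mul_sub]
  rw [e]
  exact eLpNorm_smul_le_mul_eLpNorm ((hp k).sub hg).1 hf.1

lemma MemLp.coord {ν : Measure Plane} {u : Plane → Plane} (hu : MemLp u 2 ν) (i : Fin 2) :
    MemLp (fun x => u x i) 2 ν :=
  (EuclideanSpace.proj (𝕜 := ℝ) i).comp_memLp' hu

lemma tendsto_eLpNorm_coord {ν : Measure Plane} {g : Plane → Plane} {p : ℕ → Plane → Plane}
    (h : Tendsto (fun k => eLpNorm (fun x => p k x - g x) 2 ν) atTop (𝓝 0)) (i : Fin 2) :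
    Tendsto (fun k => eLpNorm (fun x => p k x i - g x i) 2 ν) atTop (𝓝 0) := by
  refine tendsto_of_tendsto_of_tendsto_of_le_of_le tendsto_const_nhds h (fun _ => bot_le)
    fun k => eLpNorm_mono fun x => ?_
  exact PiLp.norm_apply_le (p k x - g x) i

lemma contDiff_coord {v : Plane → Plane} {n : WithTop ℕ∞} (hv : ContDiff ℝ n v) (i : Fin 2) :
    ContDiff ℝ n fun x => v x i :=
  (EuclideanSpace.proj (𝕜 := ℝ) i).contDiff.comp hv

lemma fderiv_coord {v : Plane → Plane} (hv : ContDiff ℝ 1 v) (i : Fin 2) (x h : Plane) :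
    fderiv ℝ (fun x => v x i) x h = fderiv ℝ v x h i := by
  have := ((EuclideanSpace.proj (𝕜 := ℝ) i).hasFDerivAt (x := v x)).comp x
    ((hv.differentiable (by simp)) x).hasFDerivAt
  have h2 : HasFDerivAt (fun x => v x i) _ x := this
  rw [h2.fderiv]
  rfl

/-- Integration by parts on the disk. -/
lemma integral_ball_parts_smooth {c : Plane} {R : ℝ} (hR : 0 < R) {v : Plane → Plane}
    (hv : ContDiff ℝ 1 v) {ψ : Plane → ℝ} (hψ : ContDiff ℝ 1 ψ) (i j : Fin 2) :
    (∫ x in Metric.ball c R, ψ x * jac v x i j) +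
      ∫ x in Metric.ball c R, fderiv ℝ ψ x (EuclideanSpace.single j 1) * v x i =
      ∫ x, (ψ x * ((x - c) j / R)) * v x i ∂circleMeasure c R := by
  have hvi := contDiff_coord hv i
  have hdψ : Continuous fun x => fderiv ℝ ψ x (EuclideanSpace.single j 1) :=
    (hψ.continuous_fderiv (by simp)).clm_apply continuous_const
  have key := integral_ball_fderiv (c := c) hR (f := fun x => ψ x * v x i) (hψ.mul hvi) j
  rw [← integral_add]
  · refine (integral_congr_ae (Eventually.of_forall fun x => ?_)).trans (key.trans ?_)
    · have e := (((hψ.differentiable (by simp)) x).hasFDerivAt.mul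
        ((hvi.differentiable (by simp)) x).hasFDerivAt).fderiv
      have e' : fderiv ℝ (fun x => ψ x * v x i) x = _ := e
      simp only [e', jac, add_apply, smul_apply,
        fderiv_coord hv, smul_eq_mul]
      ring
    · refine integral_congr_ae (Eventually.of_forall fun x => ?_)
      ring
  · exact (memLp_ball_of_continuous hψ.continuous c R).integrable_mul
      (memLp_ball_of_continuous (continuous_jac hv i j) c R)
  · exact (memLp_ball_of_continuous hdψ c R).integrable_mul
      (memLp_ball_of_continuous hvi.continuous c R)

lemma hasWeakJacobian_of_contDiff {c : Plane} {R : ℝ} (hR : 0 < R) {v : Plane → Plane}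
    (hv : ContDiff ℝ 1 v) : HasWeakJacobian (Metric.ball c R) v (jac v) := by
  refine ⟨memLp_ball_of_continuous hv.continuous c R,
    fun i j => memLp_ball_of_continuous (continuous_jac hv i j) c R, fun i j φ hφ _ hs => ?_⟩
  have key := integral_ball_parts_smooth (c := c) hR hv
    (hφ.of_le (by exact_mod_cast le_top) : ContDiff ℝ 1 φ) i j
  have h0 : ∫ x, (φ x * ((x - c) j / R)) * v x i ∂circleMeasure c R = 0 := by
    refine integral_eq_zero_of_ae ((ae_circleMeasure_mem_sphere hR).mono fun x hx => ?_)
    have : φ x = 0 := by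
      by_contra hne
      have := hs (subset_tsupport φ hne)
      rw [Metric.mem_ball, Metric.mem_sphere.1 hx] at this
      exact lt_irrefl _ this
    simp [this]
  rw [h0] at key
  simp only [mul_comm] at key ⊢
  linarith

lemma isTrace_of_contDiff {c : Plane} {R : ℝ} (hR : 0 < R) {v : Plane → Plane}
    (hv : ContDiff ℝ ∞ v) : IsTrace (Metric.ball c R) (circleMeasure c R) v (jac v) v :=
  ⟨memLp_circle_of_continuous hv.continuous c hR, fun _ => v, fun _ => hv, by simp,
    fun i j => by simp [jac], by simp⟩

/-- Integration by parts for a field of `H¹` of the disk. -/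
lemma integral_ball_parts {c : Plane} {R : ℝ} (hR : 0 < R) {u g : Plane → Plane}
    {G : Plane → Matrix (Fin 2) (Fin 2) ℝ} (hu : HasWeakJacobian (Metric.ball c R) u G)
    (hg : IsTrace (Metric.ball c R) (circleMeasure c R) u G g) {ψ : Plane → ℝ}
    (hψ : ContDiff ℝ 1 ψ) (i j : Fin 2) :
    (∫ x in Metric.ball c R, ψ x * G x i j) +
      ∫ x in Metric.ball c R, fderiv ℝ ψ x (EuclideanSpace.single j 1) * u x i =
      ∫ x, (ψ x * ((x - c) j / R)) * g x i ∂circleMeasure c R := by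
  obtain ⟨hg2, φ, hφ, h1, h2, h3⟩ := hg
  have hφ1 : ∀ k, ContDiff ℝ 1 (φ k) := fun k => (hφ k).of_le (by exact_mod_cast le_top)
  have hdψ : Continuous fun x => fderiv ℝ ψ x (EuclideanSpace.single j 1) :=
    (hψ.continuous_fderiv (by simp)).clm_apply continuous_const
  have hψc := hψ.continuous
  have l1 := tendsto_integral_mul_of_eLpNorm (memLp_ball_of_continuous hψ.continuous c R)
    (hu.memLp_jacobian i j) (fun k => memLp_ball_of_continuous (continuous_jac (hφ1 k) i j) c R)
    (h2 i j)
  have l2 := tendsto_integral_mul_of_eLpNorm (memLp_ball_of_continuous hdψ c R)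
    (MemLp.coord hu.memLp i)
    (fun k => memLp_ball_of_continuous (contDiff_coord (hφ1 k) i).continuous c R)
    (tendsto_eLpNorm_coord h1 i)
  have l3 := tendsto_integral_mul_of_eLpNorm
    (memLp_circle_of_continuous (f := fun x => ψ x * ((x - c) j / R)) (by fun_prop) c hR)
    (MemLp.coord hg2 i)
    (fun k => memLp_circle_of_continuous (contDiff_coord (hφ1 k) i).continuous c hR)
    (tendsto_eLpNorm_coord h3 i)
  refine tendsto_nhds_unique (l1.add l2) (l3.congr fun k => ?_)
  exact (integral_ball_parts_smooth hR (hφ1 k) hψ i j).symm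

lemma frob_strain_right (lam mu : ℝ) (M N : Matrix (Fin 2) (Fin 2) ℝ) :
    frob (hooke lam mu (strain M)) (strain N) = ∑ i, ∑ j, hooke lam mu (strain M) i j * N i j := by
  simp [frob, hooke, strain, Fin.sum_univ_two, Matrix.trace, Matrix.one_apply]
  ring

lemma frob_hooke_strain_comm (lam mu : ℝ) (M N : Matrix (Fin 2) (Fin 2) ℝ) :
    frob (hooke lam mu (strain M)) (strain N) = frob (hooke lam mu (strain N)) (strain M) := by
  simp [frob, hooke, strain, Fin.sum_univ_two, Matrix.trace, Matrix.one_apply]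
  ring

lemma continuous_hooke_strain_jac (lam mu : ℝ) {v : Plane → Plane} (hv : ContDiff ℝ 1 v)
    (i j : Fin 2) : Continuous fun x => hooke lam mu (strain (jac v x)) i j := by
  have h00 := continuous_jac hv 0 0
  have h01 := continuous_jac hv 0 1
  have h10 := continuous_jac hv 1 0
  have h11 := continuous_jac hv 1 1
  have hij := continuous_jac hv i j
  have hji := continuous_jac hv j i
  simp only [hooke, strain, Matrix.trace, Fin.sum_univ_two, Matrix.add_apply, Matrix.smul_apply,
    Matrix.transpose_apply, Matrix.diag_apply, smul_eq_mul]
  fun_prop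

/-- A classical mode satisfies the weak equation for all test fields of `H¹`. -/
lemma IsClassicalMode.weak_form {lam mu R Λ : ℝ} {U : ℂ → ℂ} (hU : IsClassicalMode lam mu R Λ U)
    (hR : 0 < R) (c : Plane) {v h : Plane → Plane} {H : Plane → Matrix (Fin 2) (Fin 2) ℝ}
    (hv : HasWeakJacobian (Metric.ball c R) v H)
    (hh : IsTrace (Metric.ball c R) (circleMeasure c R) v H h) :
    ∫ x in Metric.ball c R, frob (hooke lam mu (strain (jac (planeField c U) x))) (strain (H x)) =
      Λ * ∫ x, inner ℝ (planeField c U x) (h x) ∂circleMeasure c R := by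
  obtain ⟨hh2, φ, hφ, h1, h2, h3⟩ := hh
  have hφ1 : ∀ k, ContDiff ℝ 1 (φ k) := fun k => (hφ k).of_le (by exact_mod_cast le_top)
  have hw : ContDiff ℝ ∞ (planeField c U) := contDiff_planeField hU.contDiff
  have hw1 : ContDiff ℝ 1 (planeField c U) := hw.of_le (by exact_mod_cast le_top)
  have hS := fun i j => memLp_ball_of_continuous (continuous_hooke_strain_jac lam mu hw1 i j) c R
  have hwi := fun i => memLp_circle_of_continuous (contDiff_coord hw i).continuous c hR
  have l1 := tendsto_finsetSum Finset.univ fun i (_ : i ∈ Finset.univ) =>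
    tendsto_finsetSum Finset.univ fun j (_ : j ∈ Finset.univ) =>
      tendsto_integral_mul_of_eLpNorm (hS i j) (hv.memLp_jacobian i j)
        (fun k => memLp_ball_of_continuous (continuous_jac (hφ1 k) i j) c R) (h2 i j)
  have l2 := (tendsto_finsetSum Finset.univ fun i (_ : i ∈ Finset.univ) =>
    tendsto_integral_mul_of_eLpNorm (hwi i) (MemLp.coord hh2 i)
      (fun k => memLp_circle_of_continuous (contDiff_coord (hφ1 k) i).continuous c hR)
      (tendsto_eLpNorm_coord h3 i)).const_mul Λ
  have e1 : ∀ (N : Plane → Matrix (Fin 2) (Fin 2) ℝ),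
      (∀ i j, MemLp (fun x => N x i j) 2 (volume.restrict (Metric.ball c R))) →
      ∫ x in Metric.ball c R,
        frob (hooke lam mu (strain (jac (planeField c U) x))) (strain (N x)) =
      ∑ i, ∑ j, ∫ x in Metric.ball c R,
        hooke lam mu (strain (jac (planeField c U) x)) i j * N x i j := by
    intro N hN
    simp only [frob_strain_right]
    refine (integral_finsetSum _ fun i _ => integrable_finsetSum _ fun j _ =>
      (hS i j).integrable_mul (hN i j)).trans ?_
    exact Finset.sum_congr rfl fun i _ => integral_finsetSum _ fun j _ =>
      (hS i j).integrable_mul (hN i j)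
  have e2 : ∀ (p : Plane → Plane), MemLp p 2 (circleMeasure c R) →
      ∫ x, inner ℝ (planeField c U x) (p x) ∂circleMeasure c R =
      ∑ i, ∫ x, planeField c U x i * p x i ∂circleMeasure c R := by
    intro p hp
    refine Eq.trans ?_ (integral_finsetSum _ fun i _ =>
      (hwi i).integrable_mul (MemLp.coord hp i))
    refine integral_congr_ae (Eventually.of_forall fun x => ?_)
    simp [PiLp.inner_apply, mul_comm]
  rw [e1 H hv.memLp_jacobian, e2 h hh2]
  refine tendsto_nhds_unique l1 (l2.congr fun k => ?_)
  have key := hU.weak_form_smooth hR c (hφ k)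
  rw [e1 _ fun i j => memLp_ball_of_continuous (continuous_jac (hφ1 k) i j) c R,
    e2 _ (memLp_circle_of_continuous (hφ k).continuous c hR)] at key
  exact key.symm

lemma IsClassicalMode.isSolution {lam mu R Λ : ℝ} {U : ℂ → ℂ} (hU : IsClassicalMode lam mu R Λ U)
    (hR : 0 < R) (c : Plane) :
    IsSolution (Metric.ball c R) (circleMeasure c R) lam mu Λ (planeField c U) :=
  have hw : ContDiff ℝ ∞ (planeField c U) := contDiff_planeField hU.contDiff
  ⟨_, _, hasWeakJacobian_of_contDiff hR (hw.of_le (by exact_mod_cast le_top)),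
    isTrace_of_contDiff hR hw, fun _ _ _ hv hh => hU.weak_form hR c hv hh⟩

/-! ### Fields of zero trace and zero strain -/

/-- On a disk, every smooth function of compact support has a primitive in the direction `e_j`: its
integral over a long segment, which is a convolution and so of class `C¹`. -/
lemma exists_primitive {η : Plane → ℝ} (hη : ContDiff ℝ ∞ η) (hc : HasCompactSupport η)
    (c : Plane) (R : ℝ) (j : Fin 2) :
    ∃ ψ : Plane → ℝ, ContDiff ℝ 1 ψ ∧
      ∀ x ∈ Metric.ball c R, fderiv ℝ ψ x (EuclideanSpace.single j 1) = η x := by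
  obtain ⟨ρ, hρ⟩ := hc.isCompact.isBounded.subset_ball 0
  set e : Plane := EuclideanSpace.single j 1 with he
  have hne : ‖e‖ = 1 := by simp [he]
  set T : ℝ := max 0 (ρ + ‖c‖ + R) with hT
  have hT0 : 0 ≤ T := le_max_left _ _
  have hm : Continuous fun t : ℝ => t • e := by fun_prop
  let ν : Measure Plane := Measure.map (fun t : ℝ => t • e) (volume.restrict (Set.Ioc 0 T))
  have : IsFiniteMeasure ν := Measure.isFiniteMeasure_map _ _
  have hψ : ContDiff ℝ 1 (MeasureTheory.convolution (fun _ : Plane => (1 : ℝ)) η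
      (ContinuousLinearMap.mul ℝ ℝ) ν) :=
    hc.contDiff_convolution_right (n := 1) _ (integrable_const _).locallyIntegrable
      (hη.of_le (by exact_mod_cast le_top))
  refine ⟨_, hψ, fun x hx => ?_⟩
  have hval : ∀ y, MeasureTheory.convolution (fun _ : Plane => (1 : ℝ)) η
      (ContinuousLinearMap.mul ℝ ℝ) ν y = ∫ t in (0 : ℝ)..T, η (y - t • e) := by
    intro y
    rw [MeasureTheory.convolution_def, integral_map hm.aemeasurable,
      intervalIntegral.integral_of_le hT0]
    · simp
    · have := hη.continuous
      exact Continuous.aestronglyMeasurable (by fun_prop)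
  have hk : Continuous fun s : ℝ => η (x + s • e) := by
    have := hη.continuous
    fun_prop
  have hline : ∀ s : ℝ, MeasureTheory.convolution (fun _ : Plane => (1 : ℝ)) η
      (ContinuousLinearMap.mul ℝ ℝ) ν (x + s • e) =
      (∫ t in (0 : ℝ)..s, η (x + t • e)) - ∫ t in (0 : ℝ)..(s - T), η (x + t • e) := by
    intro s
    rw [hval, intervalIntegral.integral_interval_sub_left (hk.intervalIntegrable _ _)
      (hk.intervalIntegrable _ _)]
    have := intervalIntegral.integral_comp_sub_left (fun t => η (x + t • e)) s (a := 0) (b := T)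
    rw [sub_zero] at this
    rw [← this]
    refine intervalIntegral.integral_congr fun t _ => ?_
    congr 1
    module
  have hd1 : HasDerivAt (fun s : ℝ => (∫ t in (0 : ℝ)..s, η (x + t • e)) -
      ∫ t in (0 : ℝ)..(s - T), η (x + t • e)) (η (x + (0 : ℝ) • e) - η (x + (0 - T) • e)) 0 := by
    have h1 := fun s : ℝ => intervalIntegral.integral_hasDerivAt_right
      (hk.intervalIntegrable 0 s) (hk.stronglyMeasurableAtFilter _ _) hk.continuousAt
    exact (h1 0).sub (HasDerivAt.comp_sub_const (0 : ℝ) T (h1 (0 - T)))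
  have hout : η (x + (0 - T) • e) = 0 := by
    by_contra hne'
    have h1 := hρ (subset_tsupport η hne')
    rw [mem_ball_zero_iff] at h1
    have h2 : ‖x‖ < ‖c‖ + R := by
      have := norm_sub_norm_le x c
      have := mem_ball_iff_norm.1 hx
      linarith
    have h3 : ‖(T : ℝ) • e‖ ≤ ‖x + (0 - T) • e‖ + ‖x‖ := by
      have := norm_sub_le x (x + (0 - T) • e)
      rw [show x - (x + (0 - T) • e) = T • e by module] at this
      linarith
    rw [norm_smul, hne, Real.norm_of_nonneg hT0, mul_one] at h3
    have := le_max_right 0 (ρ + ‖c‖ + R)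
    linarith
  have hd2 := ((hψ.differentiable (by simp)) (x + (0 : ℝ) • e)).hasFDerivAt.comp_hasDerivAt (0 : ℝ)
    (((hasDerivAt_id (0 : ℝ)).smul_const e).const_add x)
  have hd3 := hd2.unique (hd1.congr_of_eventuallyEq (Eventually.of_forall hline))
  rw [hout] at hd3
  simpa using hd3

/-- A field of `H¹` of the disk with zero trace whose strain has zero diagonal vanishes: its
component `u_j` is orthogonal to all derivatives `∂_j ψ`, hence to all test functions. -/
lemma ae_eq_zero_of_trace_zero {c : Plane} {R : ℝ} (hR : 0 < R) {u g : Plane → Plane}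
    {G : Plane → Matrix (Fin 2) (Fin 2) ℝ} (hu : HasWeakJacobian (Metric.ball c R) u G)
    (hg : IsTrace (Metric.ball c R) (circleMeasure c R) u G g)
    (hg0 : ∀ᵐ x ∂circleMeasure c R, g x = 0)
    (hG : ∀ᵐ x ∂volume.restrict (Metric.ball c R), ∀ j, G x j j = 0) :
    ∀ᵐ x ∂volume.restrict (Metric.ball c R), u x = 0 := by
  have hj : ∀ j, ∀ᵐ x ∂volume.restrict (Metric.ball c R), u x j = 0 := by
    intro j
    have : IsFiniteMeasure (volume.restrict (Metric.ball c R)) :=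
      ⟨by rw [Measure.restrict_apply_univ]; exact measure_ball_lt_top⟩
    refine ae_eq_zero_of_integral_contDiff_smul_eq_zero
      ((MemLp.coord hu.memLp j).integrable (by norm_num)).locallyIntegrable fun η hη hc => ?_
    obtain ⟨ψ, hψ, hd⟩ := exists_primitive hη hc c R j
    have key := integral_ball_parts hR hu hg hψ j j
    have h1 : ∫ x in Metric.ball c R, ψ x * G x j j = 0 :=
      integral_eq_zero_of_ae (hG.mono fun x hx => by simp [hx j])
    have h2 : ∫ x, (ψ x * ((x - c) j / R)) * g x j ∂circleMeasure c R = 0 :=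
      integral_eq_zero_of_ae (hg0.mono fun x hx => by simp [hx])
    rw [h1, h2, zero_add, setIntegral_congr_fun measurableSet_ball
      fun x hx => by rw [hd x hx]] at key
    simpa using key
  filter_upwards [hj 0, hj 1] with x h0 h1
  ext i
  fin_cases i
  · exact h0
  · exact h1

/-! ### The modes of the disk -/

lemma hasFDerivAt_wirtinger_pow (k : ℕ) (z : ℂ) :
    HasFDerivAt (fun z : ℂ => z ^ k) (wirtinger (k * z ^ (k - 1)) 0) z :=
  (hasDerivAt_pow k z).complexToReal_fderiv.congr_fderiv (by ext; simp [mul_comm])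

lemma hasFDerivAt_wirtinger_conj_pow (k : ℕ) (z : ℂ) :
    HasFDerivAt (fun z : ℂ => conj z ^ k) (wirtinger 0 (k * conj z ^ (k - 1))) z := by
  simpa using hasFDerivAt_wirtinger_conj (hasFDerivAt_wirtinger_pow k z)

lemma wirtinger_congr {F G : ℂ → ℂ} {a b a' b' z : ℂ} (h : HasFDerivAt F (wirtinger a b) z)
    (hF : ∀ z, G z = F z) (ha : a' = a) (hb : b' = b) : HasFDerivAt G (wirtinger a' b') z := by
  rw [funext hF, ha, hb]
  exact h

lemma contDiff_conj : ContDiff ℝ ∞ (fun z : ℂ => conj z) := Complex.conjCLE.contDiff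

/-- The antiholomorphic mode `α z̄^m`. -/
def antiholMode (α : ℂ) (m : ℕ) (z : ℂ) : ℂ := α * conj z ^ m

lemma isClassicalMode_antihol (lam mu : ℝ) {R : ℝ} (hR : 0 < R) (α : ℂ) (m : ℕ) :
    IsClassicalMode lam mu R (2 * mu * m / R) (antiholMode α m) := by
  refine ⟨contDiff_const.mul (contDiff_conj.pow m), fun _ => 0, fun z => α * (m * conj z ^ (m - 1)),
    fun _ => 0, fun _ => 0, fun z => ?_, fun z => ?_, fun z => ?_, continuous_const,
    continuous_const, by simp, fun z hz => ?_⟩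
  · exact wirtinger_congr (hasFDerivAt_wirtinger_mul (hasFDerivAt_wirtinger_const α z)
      (hasFDerivAt_wirtinger_conj_pow m z)) (fun _ => rfl) (by ring) (by ring)
  · simpa using hasFDerivAt_wirtinger_const 0 z
  · exact ⟨_, wirtinger_congr (hasFDerivAt_wirtinger_mul
      (hasFDerivAt_wirtinger_const (mu * α * m) z)
      (hasFDerivAt_wirtinger_conj_pow (m - 1) z)) (fun _ => by ring) (by ring) rfl⟩
  · have : (R : ℂ) ≠ 0 := Complex.ofReal_ne_zero.2 hR.ne'
    rcases m with _ | m
    · simp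
    · simp [antiholMode]
      field_simp
      ring

/-- The linear mode `α z`: a dilation for real `α`, an infinitesimal rotation for imaginary `α`. -/
def linearMode (α : ℂ) (z : ℂ) : ℂ := α * z

lemma isClassicalMode_linear (lam mu R : ℝ) {α : ℂ} {Λ : ℝ}
    (h : (Λ * R : ℂ) * α = 2 * (lam + mu) * α.re) :
    IsClassicalMode lam mu R Λ (linearMode α) := by
  refine ⟨contDiff_const.mul contDiff_id, fun _ => α, fun z => 0,
    fun _ => 0, fun _ => 0, fun z => ?_, fun z => ?_, fun z => ?_, continuous_const,
    continuous_const, by simp, fun z hz => ?_⟩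
  · exact wirtinger_congr (hasFDerivAt_wirtinger_mul (hasFDerivAt_wirtinger_const α z)
      (hasFDerivAt_wirtinger_pow 1 z)) (fun _ => by simp [linearMode]) (by simp) (by simp)
  · simpa using hasFDerivAt_wirtinger_const _ z
  · exact ⟨0, by simpa using hasFDerivAt_wirtinger_const 0 z⟩
  · simp [linearMode]
    linear_combination - z * h

/-- The mode `κ φ(z) - z conj φ'(z) - conj ψ(z)` given by the Kolosov-Muskhelishvili formula, with
`κ = (λ + 3 μ) / (λ + μ)` and the potentials `φ = α z^(p+2)`, `ψ = - (p+2) α R² z^p`. The choice of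
`ψ` makes the last two terms cancel on the circle `|z| = R`. -/
def kolosovMode (lam mu R : ℝ) (α : ℂ) (p : ℕ) (z : ℂ) : ℂ :=
  ((lam + 3 * mu) / (lam + mu)) * α * z ^ (p + 2) -
    (p + 2) * conj α * (z * conj z - R ^ 2) * conj z ^ p

lemma isClassicalMode_kolosov {lam mu R : ℝ} (hmu : 0 < mu) (hlam : 0 < lam + mu) (hR : 0 < R)
    (α : ℂ) (p : ℕ) :
    IsClassicalMode lam mu R (2 * mu * (p + 2) * (lam + mu) / ((lam + 3 * mu) * R))
      (kolosovMode lam mu R α p) := by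
  have hl : (lam + mu : ℂ) ≠ 0 := by exact_mod_cast hlam.ne'
  have hl3 : (lam + 3 * mu : ℂ) ≠ 0 := by
    have : lam + 3 * mu ≠ 0 := by linarith
    exact_mod_cast this
  have hRC : (R : ℂ) ≠ 0 := Complex.ofReal_ne_zero.2 hR.ne'
  -- `p z̄^(p-1) z̄ = p z̄^p`, also for `p = 0`
  have hp : ∀ w : ℂ, (p : ℂ) * w ^ (p - 1) * w = p * w ^ p := fun w => by
    rcases p with _ | p
    · simp
    · simp [pow_succ, mul_assoc]
  have h2 : conj (2 : ℂ) = 2 := map_ofNat _ 2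
  have hconj : Continuous fun z : ℂ => conj z := Complex.continuous_conj
  have hD : ∀ z : ℂ, ((((lam + mu) * ((p + 2) * ((lam + 3 * mu) / (lam + mu) * α * z ^ (p + 1) -
      conj α * conj z ^ (p + 1)) : ℂ).re : ℝ)) : ℂ) =
      mu * (p + 2) * (α * z ^ (p + 1) + conj α * conj z ^ (p + 1)) := by
    intro z
    rw [Complex.ofReal_mul, Complex.re_eq_add_conj]
    simp only [map_mul, map_sub, map_add, map_div₀, Complex.conj_ofReal, map_natCast, map_ofNat,
      map_pow, Complex.conj_conj]
    push_cast
    field_simp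
    ring
  refine ⟨?_, fun z => (p + 2) * ((lam + 3 * mu) / (lam + mu) * α * z ^ (p + 1) -
      conj α * conj z ^ (p + 1)),
    fun z => - (p + 2) * conj α * (z * conj z ^ p +
      (z * conj z - R ^ 2) * (p * conj z ^ (p - 1))),
    fun z => mu * (p + 2) * (p + 1) * α * z ^ p,
    fun z => - mu * (p + 2) * (p + 1) * conj α * conj z ^ p,
    fun z => ?_, fun z => ?_, fun z => ?_, by fun_prop, by fun_prop, fun z => ?_, fun z hz => ?_⟩
  · exact (contDiff_const.mul (contDiff_id.pow _)).sub
      ((contDiff_const.mul ((contDiff_id.mul contDiff_conj).sub contDiff_const)).mul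
        (contDiff_conj.pow _))
  · refine wirtinger_congr (hasFDerivAt_wirtinger_add
      (hasFDerivAt_wirtinger_mul (hasFDerivAt_wirtinger_const ((lam + 3 * mu) / (lam + mu) * α) z)
        (hasFDerivAt_wirtinger_pow (p + 2) z))
      (hasFDerivAt_wirtinger_mul (hasFDerivAt_wirtinger_const (- (p + 2) * conj α) z)
        (hasFDerivAt_wirtinger_add
          (hasFDerivAt_wirtinger_mul (hasFDerivAt_wirtinger_pow 1 z)
            (hasFDerivAt_wirtinger_conj_pow (p + 1) z))
          (hasFDerivAt_wirtinger_mul (hasFDerivAt_wirtinger_const (- R ^ 2) z)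
            (hasFDerivAt_wirtinger_conj_pow p z))))) (fun z => ?_) ?_ ?_
    · simp only [kolosovMode]
      ring
    · simp
      ring
    · simp only [pow_one, Nat.cast_add, Nat.cast_one, add_tsub_cancel_right]
      linear_combination (- (p + 2) * conj α * z) * hp (conj z)
  · refine wirtinger_congr (hasFDerivAt_wirtinger_mul
      (hasFDerivAt_wirtinger_const (mu * (p + 2)) z) (hasFDerivAt_wirtinger_add
        (hasFDerivAt_wirtinger_mul (hasFDerivAt_wirtinger_const α z)
          (hasFDerivAt_wirtinger_pow (p + 1) z))
        (hasFDerivAt_wirtinger_mul (hasFDerivAt_wirtinger_const (conj α) z)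
          (hasFDerivAt_wirtinger_conj_pow (p + 1) z)))) hD ?_ ?_
    · simp
      ring
    · simp [h2]
      ring
  · refine ⟨_, wirtinger_congr (hasFDerivAt_wirtinger_mul
      (hasFDerivAt_wirtinger_const (- mu * (p + 2) * conj α) z) (hasFDerivAt_wirtinger_add
        (hasFDerivAt_wirtinger_mul (hasFDerivAt_wirtinger_const (p + 1) z)
          (hasFDerivAt_wirtinger_mul (hasFDerivAt_wirtinger_pow 1 z)
            (hasFDerivAt_wirtinger_conj_pow p z)))
        (hasFDerivAt_wirtinger_mul (hasFDerivAt_wirtinger_const (- R ^ 2 * p) z)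
          (hasFDerivAt_wirtinger_conj_pow (p - 1) z)))) (fun z => ?_) ?_ rfl⟩
    · linear_combination - mu * (p + 2) * conj α * z * hp (conj z)
    · simp
      ring
  · simp [h2]
  · have hzz : z * conj z = R ^ 2 := by
      rw [Complex.mul_conj, Complex.normSq_eq_norm_sq, hz]
      push_cast
      rfl
    rw [hD]
    simp only [kolosovMode, hzz]
    push_cast
    have hl3' : (lam + mu * 3 : ℂ) ≠ 0 := by rwa [mul_comm (mu : ℂ)]
    field_simp
    ring

/-- The modes of the disk of radius `R`, as functions of `z = x - c`. -/
def modeC (lam mu R : ℝ) : DiskIndex → ℂ → ℂ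
  | .one 0 => antiholMode 1 0
  | .one 1 => antiholMode Complex.I 0
  | .one 2 => linearMode Complex.I
  | .two => linearMode 1
  | .three 0 => kolosovMode lam mu R 1 0
  | .three 1 => kolosovMode lam mu R (-Complex.I) 0
  | .four n _ 0 => antiholMode 1 (n - 1)
  | .four n _ 1 => antiholMode Complex.I (n - 1)
  | .five n _ 0 => kolosovMode lam mu R (1 / n) (n - 1)
  | .five n _ 1 => kolosovMode lam mu R (Complex.I / n) (n - 1)

lemma isClassicalMode_modeC {lam mu R : ℝ} (hmu : 0 < mu) (hlam : 0 < lam + mu) (hR : 0 < R)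
    (i : DiskIndex) : IsClassicalMode lam mu R (diskEigenvalue lam mu R i) (modeC lam mu R i) := by
  have hRC : (R : ℂ) ≠ 0 := Complex.ofReal_ne_zero.2 hR.ne'
  have hn1 : ∀ n : ℕ, 2 ≤ n → ((n - 1 : ℕ) : ℝ) = n - 1 := fun n hn => by
    rw [Nat.cast_sub (by omega)]; simp
  have anti : ∀ (Λ : ℝ) (α : ℂ) (m : ℕ), Λ = 2 * mu * m / R →
      IsClassicalMode lam mu R Λ (antiholMode α m) := fun Λ α m h =>
    h ▸ isClassicalMode_antihol lam mu hR α m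
  have kol : ∀ (Λ : ℝ) (α : ℂ) (p : ℕ),
      Λ = 2 * mu * (p + 2) * (lam + mu) / ((lam + 3 * mu) * R) →
      IsClassicalMode lam mu R Λ (kolosovMode lam mu R α p) := fun Λ α p h =>
    h ▸ isClassicalMode_kolosov hmu hlam hR α p
  match i with
  | .one 0 => exact anti _ _ _ (by simp [diskEigenvalue])
  | .one 1 => exact anti _ _ _ (by simp [diskEigenvalue])
  | .one 2 => exact isClassicalMode_linear lam mu R (by simp [diskEigenvalue])
  | .two => exact isClassicalMode_linear lam mu R (by simp [diskEigenvalue]; field_simp)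
  | .three 0 => exact kol _ _ _ (by simp only [diskEigenvalue]; push_cast; ring)
  | .three 1 => exact kol _ _ _ (by simp only [diskEigenvalue]; push_cast; ring)
  | .four n hn 0 => exact anti _ _ _ (by rw [hn1 n hn]; rfl)
  | .four n hn 1 => exact anti _ _ _ (by rw [hn1 n hn]; rfl)
  | .five n hn 0 => exact kol _ _ _ (by rw [hn1 n hn]; simp only [diskEigenvalue]; ring)
  | .five n hn 1 => exact kol _ _ _ (by rw [hn1 n hn]; simp only [diskEigenvalue]; ring)

lemma pow_eq_polar (z : ℂ) (k : ℕ) :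
    z ^ k = ⟨‖z‖ ^ k * Real.cos (k * z.arg), ‖z‖ ^ k * Real.sin (k * z.arg)⟩ := by
  have h : z ^ k = ((‖z‖ ^ k : ℝ) : ℂ) * Complex.exp (((k * z.arg : ℝ) : ℂ) * Complex.I) := by
    conv_lhs => rw [← Complex.norm_mul_exp_arg_mul_I z, mul_pow, ← Complex.exp_nat_mul]
    push_cast
    ring_nf
  rw [h]
  apply Complex.ext
  · rw [Complex.re_ofReal_mul, Complex.exp_ofReal_mul_I_re]
  · rw [Complex.im_ofReal_mul, Complex.exp_ofReal_mul_I_im]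

lemma antiholMode_eq_polar (α z : ℂ) (m : ℕ) : antiholMode α m z =
    ⟨‖z‖ ^ m * (α.re * Real.cos (m * z.arg) + α.im * Real.sin (m * z.arg)),
      ‖z‖ ^ m * (α.im * Real.cos (m * z.arg) - α.re * Real.sin (m * z.arg))⟩ := by
  rw [antiholMode, ← map_pow, pow_eq_polar]
  apply Complex.ext <;> simp <;> ring

lemma kolosovMode_eq_polar (lam mu R : ℝ) (α z : ℂ) (p : ℕ) : kolosovMode lam mu R α p z =
    ⟨(lam + 3 * mu) / (lam + mu) * ‖z‖ ^ (p + 2) *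
        (α.re * Real.cos ((p + 2) * z.arg) - α.im * Real.sin ((p + 2) * z.arg)) -
      (p + 2) * (‖z‖ ^ 2 - R ^ 2) * ‖z‖ ^ p *
        (α.re * Real.cos (p * z.arg) - α.im * Real.sin (p * z.arg)),
    (lam + 3 * mu) / (lam + mu) * ‖z‖ ^ (p + 2) *
        (α.re * Real.sin ((p + 2) * z.arg) + α.im * Real.cos ((p + 2) * z.arg)) +
      (p + 2) * (‖z‖ ^ 2 - R ^ 2) * ‖z‖ ^ p *
        (α.re * Real.sin (p * z.arg) + α.im * Real.cos (p * z.arg))⟩ := by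
  have h : kolosovMode lam mu R α p z =
      (((lam + 3 * mu) / (lam + mu) : ℝ) : ℂ) * (α * z ^ (p + 2)) -
        (((p + 2) * (‖z‖ ^ 2 - R ^ 2) : ℝ) : ℂ) * conj (α * z ^ p) := by
    rw [kolosovMode, Complex.mul_conj, Complex.normSq_eq_norm_sq, map_mul, map_pow]
    push_cast
    ring
  rw [h, pow_eq_polar z (p + 2), pow_eq_polar z p]
  simp only [Nat.cast_add, Nat.cast_ofNat]
  apply Complex.ext
  · rw [Complex.sub_re, Complex.re_ofReal_mul, Complex.re_ofReal_mul]
    simp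
    ring
  · rw [Complex.sub_im, Complex.im_ofReal_mul, Complex.im_ofReal_mul]
    simp
    ring

lemma polarMode_eq {lam mu R : ℝ} (hlam : 0 < lam + mu) (i : DiskIndex) (z : ℂ) :
    polarMode lam mu R ‖z‖ z.arg i = ofComplex (modeC lam mu R i z) := by
  have hlam' := hlam.ne'
  have hp : ∀ p : ℕ, ((p + 1 : ℕ) : ℝ) + 1 = p + 2 := fun p => by push_cast; ring
  have hp' : ∀ p : ℕ, ((p + 1 : ℕ) : ℝ) - 1 = p := fun p => by push_cast; ring
  rw [ofComplex_eq]
  match i with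
  | .one 0 => simp [polarMode, modeC, antiholMode]
  | .one 1 => simp [polarMode, modeC, antiholMode]
  | .one 2 =>
    ext j; fin_cases j <;> simp [polarMode, modeC, linearMode]
  | .two =>
    ext j; fin_cases j <;> simp [polarMode, modeC, linearMode]
  | .three 0 =>
    simp only [modeC, kolosovMode_eq_polar]
    ext j
    fin_cases j
    · simp [polarMode]
      field_simp
      ring
    · simp [polarMode]
      field_simp
  | .three 1 =>
    simp only [modeC, kolosovMode_eq_polar]
    ext j
    fin_cases j
    · simp [polarMode]
      field_simp
    · simp [polarMode]
      field_simp
      ring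
  | .four n hn k =>
    obtain ⟨p, rfl⟩ : ∃ p, n = p + 1 := ⟨n - 1, by omega⟩
    fin_cases k <;> simp only [modeC, antiholMode_eq_polar] <;> ext j <;> fin_cases j <;>
      simp [polarMode]
  | .five n hn k =>
    obtain ⟨p, rfl⟩ : ∃ p, n = p + 1 := ⟨n - 1, by omega⟩
    have hre : (1 / ((p + 1 : ℕ) : ℂ)) = ((1 / (p + 1) : ℝ) : ℂ) := by push_cast; rfl
    have him : (Complex.I / ((p + 1 : ℕ) : ℂ)) = ((1 / (p + 1) : ℝ) : ℂ) * Complex.I := by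
      push_cast; ring
    have h1 : (1 / ((p + 1 : ℕ) : ℂ)).re = 1 / (p + 1) := by rw [hre, Complex.ofReal_re]
    have h2 : (1 / ((p + 1 : ℕ) : ℂ)).im = 0 := by rw [hre, Complex.ofReal_im]
    have h3 : (Complex.I / ((p + 1 : ℕ) : ℂ)).re = 0 := by rw [him, Complex.re_ofReal_mul]; simp
    have h4 : (Complex.I / ((p + 1 : ℕ) : ℂ)).im = 1 / (p + 1) := by
      rw [him, Complex.im_ofReal_mul]; simp
    have h0 : (p : ℝ) + 1 ≠ 0 := by positivity
    fin_cases k <;> simp only [modeC, kolosovMode_eq_polar, h1, h2, h3,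
      h4, polarMode, hp, hp', add_tsub_cancel_right] <;>
      ext j <;> fin_cases j <;> simp <;> field_simp <;> ring

lemma diskMode_eq {lam mu R : ℝ} (hlam : 0 < lam + mu) (c : Plane) (i : DiskIndex) :
    diskMode lam mu c R i = planeField c (modeC lam mu R i) := by
  ext1 x
  have h : (⟨(x - c) 0, (x - c) 1⟩ : ℂ) = ofComplex.symm (x - c) := by
    apply Complex.ext <;> simp
  rw [diskMode, h, planeField, ← polarMode_eq hlam, LinearIsometryEquiv.norm_map]

/-- The frequency of the boundary values of a mode. -/
def freq : DiskIndex → ℤ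
  | .one 0 => 0
  | .one 1 => 0
  | .one 2 => 1
  | .two => 1
  | .three _ => 2
  | .four n _ _ => 1 - n
  | .five n _ _ => n + 1

/-- The coefficient of the boundary values of a mode. -/
def weight (lam mu R : ℝ) : DiskIndex → ℂ
  | .one 0 => 1
  | .one 1 => Complex.I
  | .one 2 => R * Complex.I
  | .two => R
  | .three 0 => ((lam + 3 * mu) / (lam + mu) * R ^ 2 : ℝ)
  | .three 1 => ((lam + 3 * mu) / (lam + mu) * R ^ 2 : ℝ) * -Complex.I
  | .four n _ 0 => (R ^ (n - 1) : ℝ)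
  | .four n _ 1 => (R ^ (n - 1) : ℝ) * Complex.I
  | .five n _ 0 => ((lam + 3 * mu) / (lam + mu) * R ^ (n + 1) / n : ℝ)
  | .five n _ 1 => ((lam + 3 * mu) / (lam + mu) * R ^ (n + 1) / n : ℝ) * Complex.I

lemma kolosovMode_boundary (lam mu R : ℝ) (α : ℂ) (p : ℕ) (θ : ℝ) :
    kolosovMode lam mu R α p (R * Complex.exp (θ * Complex.I)) =
      ((lam + 3 * mu) / (lam + mu) * R ^ (p + 2) : ℝ) * α *
        Complex.exp (((p + 2 : ℕ) : ℂ) * (θ * Complex.I)) := by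
  have hE : Complex.exp (θ * Complex.I) * conj (Complex.exp (θ * Complex.I)) = 1 := by
    rw [Complex.mul_conj, Complex.normSq_eq_norm_sq, Complex.norm_exp_ofReal_mul_I]; simp
  rw [kolosovMode, Complex.exp_nat_mul]
  simp only [map_mul, Complex.conj_ofReal]
  push_cast
  linear_combination
    (- (p + 2) * conj α * (R * conj (Complex.exp (θ * Complex.I))) ^ p * R ^ 2) * hE

lemma antiholMode_boundary (R : ℝ) (α : ℂ) (m : ℕ) (θ : ℝ) :
    antiholMode α m (R * Complex.exp (θ * Complex.I)) =
      (R ^ m : ℝ) * α * Complex.exp (((-m : ℤ) : ℂ) * (θ * Complex.I)) := by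
  have h : Complex.exp (((-m : ℤ) : ℂ) * (θ * Complex.I)) =
      conj (Complex.exp (θ * Complex.I)) ^ m := by
    rw [← Complex.exp_conj, ← Complex.exp_nat_mul]
    simp
  rw [antiholMode, h]
  simp only [map_mul, Complex.conj_ofReal]
  push_cast
  ring

lemma modeC_boundary (lam mu R : ℝ) (i : DiskIndex) (θ : ℝ) :
    modeC lam mu R i (R * Complex.exp (θ * Complex.I)) =
      weight lam mu R i * Complex.exp ((freq i : ℂ) * (θ * Complex.I)) := by
  match i with
  | .one 0 => simp [modeC, antiholMode, weight, freq]
  | .one 1 => simp [modeC, antiholMode, weight, freq]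
  | .one 2 => simp [modeC, linearMode, weight, freq]; ring
  | .two => simp [modeC, linearMode, weight, freq]
  | .three 0 => rw [modeC, kolosovMode_boundary]; simp [weight, freq]
  | .three 1 => rw [modeC, kolosovMode_boundary]; simp [weight, freq]
  | .four n hn k =>
    obtain ⟨p, rfl⟩ : ∃ p, n = p + 1 := ⟨n - 1, by omega⟩
    fin_cases k <;> simp [modeC, antiholMode_boundary, weight, freq]
  | .five n hn k =>
    obtain ⟨p, rfl⟩ : ∃ p, n = p + 1 := ⟨n - 1, by omega⟩
    fin_cases k <;> simp [modeC, kolosovMode_boundary, weight, freq, add_assoc, one_add_one_eq_two]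
      <;> ring

/-! ### Fourier analysis on the boundary circle -/

lemma integral_exp_int (n : ℤ) :
    ∫ θ in Set.Ioc (-Real.pi) Real.pi, Complex.exp ((n : ℂ) * (θ * Complex.I)) =
      if n = 0 then 2 * Real.pi else 0 := by
  rw [← intervalIntegral.integral_of_le (by linarith [Real.pi_pos])]
  split_ifs with h
  · subst h
    simp
    ring
  · have hn : (n : ℂ) * Complex.I ≠ 0 := by simp [h]
    have e : ∀ θ : ℝ, (n : ℂ) * (θ * Complex.I) = (n * Complex.I) * θ := fun θ => by ring
    simp only [e]
    have h1 : Complex.exp (n * Complex.I * Real.pi) =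
        Complex.exp (n * Complex.I * (-Real.pi : ℝ)) :=
      Complex.exp_eq_exp_iff_exists_int.2 ⟨n, by push_cast; ring⟩
    rw [integral_exp_mul_complex hn, h1, sub_self, zero_div, Complex.ofReal_zero]

/-- A square integrable function on `(-π, π]` whose Fourier coefficients all vanish is zero. -/
lemma ae_eq_zero_of_integral_exp {f : ℝ → ℂ}
    (hf : MemLp f 2 (volume.restrict (Set.Ioc (-Real.pi) Real.pi)))
    (h : ∀ n : ℤ, ∫ θ in Set.Ioc (-Real.pi) Real.pi,
      Complex.exp ((n : ℂ) * (θ * Complex.I)) * f θ = 0) :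
    ∀ᵐ θ ∂volume.restrict (Set.Ioc (-Real.pi) Real.pi), f θ = 0 := by
  have hpi : -Real.pi < Real.pi := by linarith [Real.pi_pos]
  have hsum := hasSum_sq_fourierCoeffOn hpi hf
  have hc : ∀ n : ℤ, fourierCoeffOn hpi f n = 0 := by
    intro n
    rw [fourierCoeffOn_eq_integral, intervalIntegral.integral_of_le hpi.le]
    have e : ∀ θ : ℝ, fourier (-n) (θ : AddCircle (Real.pi - -Real.pi)) • f θ =
        Complex.exp (((-n : ℤ) : ℂ) * (θ * Complex.I)) * f θ := by
      intro θ
      have hp : (Real.pi : ℂ) ≠ 0 := by exact_mod_cast Real.pi_ne_zero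
      rw [fourier_coe_apply, smul_eq_mul]
      congr 2
      push_cast
      field_simp
      ring
    simp only [e, h, smul_zero]
  simp only [hc, norm_zero, ne_eq, OfNat.ofNat_ne_zero, not_false_eq_true, zero_pow] at hsum
  have h0 := hsum.unique hasSum_zero
  rw [intervalIntegral.integral_of_le hpi.le, smul_eq_zero, or_iff_right
    (by rw [inv_eq_zero]; linarith [Real.pi_pos]),
    integral_eq_zero_iff_of_nonneg (fun _ => by positivity) hf.integrable_norm_pow'] at h0
  filter_upwards [h0] with θ hθ
  simpa using hθ

lemma exists_index_of_freq {lam mu R : ℝ} (hmu : 0 < mu) (hlam : 0 < lam + mu) (hR : 0 < R)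
    (n : ℤ) : ∃ (i j : DiskIndex) (a b : ℝ), freq i = n ∧ freq j = n ∧ a ≠ 0 ∧ b ≠ 0 ∧
      weight lam mu R i = a ∧ weight lam mu R j = b * Complex.I := by
  have hk : 0 < (lam + 3 * mu) / (lam + mu) := div_pos (by linarith) hlam
  rcases lt_trichotomy n 0 with hn | rfl | hn
  · obtain ⟨m, rfl⟩ : ∃ m : ℕ, n = -(m + 1 : ℕ) := ⟨(-n - 1).toNat, by omega⟩
    exact ⟨.four (m + 2) (by omega) 0, .four (m + 2) (by omega) 1, _, _,
      by simp [freq]; ring, by simp [freq]; ring, (pow_pos hR _).ne', (pow_pos hR _).ne', rfl, rfl⟩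
  · exact ⟨.one 0, .one 1, 1, 1, rfl, rfl, one_ne_zero, one_ne_zero, by simp [weight],
      by simp [weight]⟩
  · obtain rfl | rfl | hn : n = 1 ∨ n = 2 ∨ 3 ≤ n := by omega
    · exact ⟨.two, .one 2, R, R, rfl, rfl, hR.ne', hR.ne', rfl, rfl⟩
    · exact ⟨.three 0, .three 1, _, -((lam + 3 * mu) / (lam + mu) * R ^ 2), rfl, rfl, by positivity,
        neg_ne_zero.2 (by positivity), rfl, by simp [weight]⟩
    · obtain ⟨m, rfl⟩ : ∃ m : ℕ, n = (m + 3 : ℕ) := ⟨(n - 3).toNat, by omega⟩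
      exact ⟨.five (m + 2) (by omega) 0, .five (m + 2) (by omega) 1, _, _, by simp [freq]; ring,
        by simp [freq]; ring, by positivity, by positivity, rfl, rfl⟩

lemma re_weight_mul_conj (lam mu R : ℝ) {i j : DiskIndex} (hij : i ≠ j) (h : freq i = freq j) :
    (weight lam mu R i * conj (weight lam mu R j)).re = 0 := by
  have key : ∀ i : DiskIndex, (∃ k : Fin 3, i = .one k) ∨ i = .two ∨ (∃ k, i = .three k) ∨
      (∃ n hn k, i = .four n hn k) ∨ ∃ n hn k, i = .five n hn k := by
    rintro (k | _ | k | ⟨n, hn, k⟩ | ⟨n, hn, k⟩) <;> simp [*]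
  have o1 : ∀ a b : ℝ, ((a : ℂ) * conj (b * Complex.I)).re = 0 := fun a b => by simp
  have o2 : ∀ a b : ℝ, ((a : ℂ) * Complex.I * conj (b : ℂ)).re = 0 := fun a b => by simp
  have o3 : ∀ a b : ℝ, ((a : ℂ) * conj (b * -Complex.I)).re = 0 := fun a b => by simp
  have o4 : ∀ a b : ℝ, ((a : ℂ) * -Complex.I * conj (b : ℂ)).re = 0 := fun a b => by simp
  obtain ⟨k, rfl⟩ | rfl | ⟨k, rfl⟩ | ⟨n, hn, k, rfl⟩ | ⟨n, hn, k, rfl⟩ := key i <;>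
  obtain ⟨l, rfl⟩ | rfl | ⟨l, rfl⟩ | ⟨m, hm, l, rfl⟩ | ⟨m, hm, l, rfl⟩ := key j <;>
  try fin_cases k
  all_goals try fin_cases l
  all_goals first
    | exact absurd rfl hij
    | (simp only [freq] at h; omega)
    | (simp only [freq] at h
       obtain rfl : n = m := by omega
       first
         | exact absurd rfl hij
         | exact o1 _ _
         | exact o2 _ _)
    | exact o1 _ _
    | exact o2 _ _
    | exact o3 _ _
    | exact o4 _ _
    | simp [weight]

lemma weight_ne_zero {lam mu R : ℝ} (hmu : 0 < mu) (hlam : 0 < lam + mu) (hR : 0 < R)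
    (i : DiskIndex) : weight lam mu R i ≠ 0 := by
  have hk : 0 < (lam + 3 * mu) / (lam + mu) := div_pos (by linarith) hlam
  have hr : ∀ {x : ℝ}, 0 < x → (x : ℂ) ≠ 0 := fun h => Complex.ofReal_ne_zero.2 h.ne'
  match i with
  | .one 0 => exact one_ne_zero
  | .one 1 => exact Complex.I_ne_zero
  | .one 2 => exact mul_ne_zero (hr hR) Complex.I_ne_zero
  | .two => exact hr hR
  | .three 0 => exact hr (by positivity)
  | .three 1 => exact mul_ne_zero (hr (by positivity)) (neg_ne_zero.2 Complex.I_ne_zero)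
  | .four n _ 0 => exact hr (by positivity)
  | .four n _ 1 => exact mul_ne_zero (hr (by positivity)) Complex.I_ne_zero
  | .five n hn 0 =>
    have : (0 : ℝ) < n := by exact_mod_cast (by omega : 0 < n)
    exact hr (by positivity)
  | .five n hn 1 =>
    have : (0 : ℝ) < n := by exact_mod_cast (by omega : 0 < n)
    exact mul_ne_zero (hr (by positivity)) Complex.I_ne_zero

lemma planeField_circlePoint (c : Plane) (lam mu R : ℝ) (i : DiskIndex) (θ : ℝ) :
    planeField c (modeC lam mu R i) (circlePoint c R θ) =
      ofComplex (weight lam mu R i * Complex.exp ((freq i : ℂ) * (θ * Complex.I))) := by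
  rw [← modeC_boundary]
  simp [planeField, circlePoint]

/-- The boundary values of distinct modes are orthogonal. -/
lemma integral_inner_modes {lam mu R : ℝ} (hmu : 0 < mu) (hlam : 0 < lam + mu) (hR : 0 < R)
    (c : Plane) (i j : DiskIndex) :
    ∫ x, inner ℝ (planeField c (modeC lam mu R i) x) (planeField c (modeC lam mu R j) x)
      ∂circleMeasure c R =
      R * (weight lam mu R i * conj (weight lam mu R j) *
        if freq i - freq j = 0 then 2 * Real.pi else 0).re := by
  have hc := fun i => (contDiff_planeField (c := c)
    (isClassicalMode_modeC hmu hlam hR i).contDiff).continuous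
  rw [integral_circleMeasure hR ((hc i).inner (hc j)).aestronglyMeasurable]
  congr 1
  have e : ∀ θ : ℝ, inner ℝ (planeField c (modeC lam mu R i) (circlePoint c R θ))
      (planeField c (modeC lam mu R j) (circlePoint c R θ)) =
      Complex.reCLM (weight lam mu R i * conj (weight lam mu R j) *
        Complex.exp (((freq i - freq j : ℤ) : ℂ) * (θ * Complex.I))) := by
    intro θ
    rw [planeField_circlePoint, planeField_circlePoint, inner_ofComplex, map_mul,
      ← Complex.exp_conj, Complex.reCLM_apply]
    congr 1
    rw [mul_mul_mul_comm, ← Complex.exp_add]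
    congr 2
    simp
    ring
  simp only [e]
  rw [ContinuousLinearMap.integral_comp_comm, integral_const_mul, integral_exp_int]
  · simp
  · exact (Continuous.integrableOn_Icc (by fun_prop)).mono_set Set.Ioc_subset_Icc_self

lemma integral_inner_modes_of_ne {lam mu R : ℝ} (hmu : 0 < mu) (hlam : 0 < lam + mu) (hR : 0 < R)
    (c : Plane) {i j : DiskIndex} (hij : i ≠ j) :
    ∫ x, inner ℝ (planeField c (modeC lam mu R i) x) (planeField c (modeC lam mu R j) x)
      ∂circleMeasure c R = 0 := by
  rw [integral_inner_modes hmu hlam hR]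
  split_ifs with h
  · have h1 := re_weight_mul_conj lam mu R hij (sub_eq_zero.1 h)
    rw [Complex.re_mul_ofReal, h1, zero_mul, mul_zero]
  · simp

lemma integral_inner_mode_self_pos {lam mu R : ℝ} (hmu : 0 < mu) (hlam : 0 < lam + mu)
    (hR : 0 < R) (c : Plane) (i : DiskIndex) :
    0 < ∫ x, inner ℝ (planeField c (modeC lam mu R i) x) (planeField c (modeC lam mu R i) x)
      ∂circleMeasure c R := by
  rw [integral_inner_modes hmu hlam hR, if_pos (sub_self _),
    Complex.re_mul_ofReal, Complex.mul_conj, Complex.ofReal_re]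
  have := Complex.normSq_pos.2 (weight_ne_zero hmu hlam hR i)
  have := Real.pi_pos
  positivity

/-- The boundary values of the modes are complete in `L²` of the circle. -/
lemma ae_eq_zero_of_orthogonal_modes {lam mu R : ℝ} (hmu : 0 < mu) (hlam : 0 < lam + mu)
    (hR : 0 < R) (c : Plane) {g : Plane → Plane} (hg : MemLp g 2 (circleMeasure c R))
    (h : ∀ i, ∫ x, inner ℝ (planeField c (modeC lam mu R i) x) (g x) ∂circleMeasure c R = 0) :
    ∀ᵐ x ∂circleMeasure c R, g x = 0 := by
  have hcirc := eLpNorm_circleMeasure hR hg.1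
  have hRne : ENNReal.ofReal R ^ (1 / 2 : ℝ) ≠ 0 := by
    simp [hR]
  have hgm : AEStronglyMeasurable (g ∘ circlePoint c R)
      (volume.restrict (Set.Ioc (-Real.pi) Real.pi)) :=
    (aestronglyMeasurable_comp_circlePoint hR hg.1).comp_measurable
      (continuous_circlePoint c R).measurable
  have hgc : MemLp (g ∘ circlePoint c R) 2 (volume.restrict (Set.Ioc (-Real.pi) Real.pi)) := by
    refine ⟨hgm, lt_top_iff_ne_top.2 fun htop => ?_⟩
    rw [htop, ENNReal.mul_top hRne] at hcirc
    exact hg.2.ne hcirc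
  let f : ℝ → ℂ := fun θ => conj (ofComplex.symm (g (circlePoint c R θ)))
  have hf : MemLp f 2 (volume.restrict (Set.Ioc (-Real.pi) Real.pi)) :=
    ((Complex.conjCLE : ℂ →L[ℝ] ℂ).comp
      (ofComplex.symm.toContinuousLinearEquiv : Plane →L[ℝ] ℂ)).comp_memLp' hgc
  have hint : ∀ n : ℤ, Integrable (fun θ : ℝ => Complex.exp ((n : ℂ) * (θ * Complex.I)) * f θ)
      (volume.restrict (Set.Ioc (-Real.pi) Real.pi)) := fun n => by
    refine (hf.integrable (by norm_num)).bdd_mul (c := 1)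
      (Continuous.aestronglyMeasurable (by fun_prop)) (Eventually.of_forall fun θ => ?_)
    rw [show (n : ℂ) * (θ * Complex.I) = ((n * θ : ℝ) : ℂ) * Complex.I by push_cast; ring,
      Complex.norm_exp_ofReal_mul_I]
  have hre : ∀ i, (weight lam mu R i * ∫ θ in Set.Ioc (-Real.pi) Real.pi,
      Complex.exp ((freq i : ℂ) * (θ * Complex.I)) * f θ).re = 0 := by
    intro i
    have h1 := h i
    have hc := (contDiff_planeField (c := c)
      (isClassicalMode_modeC hmu hlam hR i).contDiff).continuous
    rw [integral_circleMeasure hR (hc.aestronglyMeasurable.inner hg.1), mul_eq_zero,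
      or_iff_right hR.ne'] at h1
    rw [← h1, ← integral_const_mul, ← Complex.reCLM_apply,
      ← ContinuousLinearMap.integral_comp_comm _ ((hint _).const_mul _)]
    refine integral_congr_ae (Eventually.of_forall fun θ => ?_)
    beta_reduce
    rw [planeField_circlePoint, ← ofComplex.apply_symm_apply (g (circlePoint c R θ)),
      inner_ofComplex, Complex.reCLM_apply, mul_assoc]
  have hzero : ∀ᵐ θ ∂volume.restrict (Set.Ioc (-Real.pi) Real.pi), f θ = 0 := by
    refine ae_eq_zero_of_integral_exp hf fun n => ?_
    obtain ⟨i, j, a, b, rfl, hj, ha, hb, hwi, hwj⟩ := exists_index_of_freq hmu hlam hR n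
    have h1 := hre i
    have h2 := hre j
    rw [hj] at h2
    rw [hwi, Complex.re_ofReal_mul, mul_eq_zero, or_iff_right ha] at h1
    rw [hwj, mul_assoc, Complex.re_ofReal_mul, mul_eq_zero, or_iff_right hb, Complex.I_mul_re,
      neg_eq_zero] at h2
    exact Complex.ext h1 h2
  have hzero' : g ∘ circlePoint c R =ᵐ[volume.restrict (Set.Ioc (-Real.pi) Real.pi)] 0 := by
    filter_upwards [hzero] with θ hθ
    simpa [f] using hθ
  rw [eLpNorm_congr_ae hzero', eLpNorm_zero, mul_zero,
    eLpNorm_eq_zero_iff hg.1 (by norm_num)] at hcirc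
  exact hcirc

/-! ### Enumeration of the eigenvalues in increasing order -/

/-- A countable infinite family of reals with finite sublevel sets can be enumerated in increasing
order. -/
lemma exists_equiv_monotone {ι : Type*} [Countable ι] [Infinite ι] (f : ι → ℝ)
    (hf : ∀ C, {i | f i ≤ C}.Finite) : ∃ e : ℕ ≃ ι, Monotone (f ∘ e) := by
  obtain ⟨code, hcode⟩ := exists_injective_nat ι
  -- ties are broken by the code, and an index is sent to the number of its predecessors
  let key : ι → ℝ ×ₗ ℕ := fun i => toLex (f i, code i)
  have hkey : Function.Injective key := fun i j h => hcode (congrArg (fun p => (ofLex p).2) h)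
  have hle : ∀ {i j}, key i ≤ key j → f i ≤ f j := fun {i j} h => by
    rcases Prod.Lex.toLex_le_toLex.1 h with h | h
    · exact h.le
    · exact h.1.le
  have hfin : ∀ i, {j | key j < key i}.Finite := fun i =>
    (hf (f i)).subset fun j (hj : key j < key i) => hle hj.le
  let r : ι → ℕ := fun i => {j | key j < key i}.ncard
  have hr : ∀ {i j}, key i < key j → r i < r j := fun {i j} h =>
    Set.ncard_lt_ncard ⟨fun k (hk : key k < key i) => hk.trans h,
      fun hsub => lt_irrefl (key i) (hsub h)⟩ (hfin j)
  have hr' : ∀ {i j}, r i ≤ r j → key i ≤ key j := fun {i j} h =>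
    not_lt.1 fun hlt => (hr hlt).not_ge h
  have hinj : Function.Injective r := fun i j h => hkey (le_antisymm (hr' h.le) (hr' h.ge))
  have : Infinite (Set.range r) := (Set.infinite_range_of_injective hinj).to_subtype
  let E := Equiv.ofInjective r hinj
  refine ⟨(Nat.Subtype.orderIsoOfNat (Set.range r)).toEquiv.trans E.symm,
    fun a b hab => hle (hr' ?_)⟩
  have h : ∀ x : Set.range r, r (E.symm x) = x := fun x =>
    congrArg Subtype.val (E.apply_symm_apply x)
  simp only [Equiv.trans_apply, h]
  exact (Nat.Subtype.orderIsoOfNat (Set.range r)).monotone hab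

/-- An injective code of the indices of the modes. -/
def DiskIndex.code : DiskIndex → ℕ × ℕ × ℕ
  | .one k => (0, 0, k)
  | .two => (1, 0, 0)
  | .three k => (2, 0, k)
  | .four n _ k => (3, n, k)
  | .five n _ k => (4, n, k)

lemma DiskIndex.code_injective : Function.Injective DiskIndex.code := by
  rintro (k | _ | k | ⟨n, hn, k⟩ | ⟨n, hn, k⟩) (l | _ | l | ⟨m, hm, l⟩ | ⟨m, hm, l⟩) h <;>
    first
    | rfl
    | (simp [DiskIndex.code] at h; done)
    | (simp only [DiskIndex.code, Prod.mk.injEq, Fin.val_inj, true_and] at h; simp [h])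

instance : Countable DiskIndex := DiskIndex.code_injective.countable

instance : Infinite DiskIndex :=
  Infinite.of_injective (fun n : ℕ => DiskIndex.four (n + 2) (by omega) 0) fun n m h => by
    simpa using h

lemma finite_diskEigenvalue_le {lam mu R : ℝ} (hmu : 0 < mu) (hlam : 0 < lam + mu) (hR : 0 < R)
    (C : ℝ) : {i | diskEigenvalue lam mu R i ≤ C}.Finite := by
  set N₁ := ⌈C * R / (2 * mu) + 1⌉₊
  set N₂ := ⌈C * ((lam + 3 * mu) * R) / (2 * mu * (lam + mu))⌉₊
  have hl3 : 0 < lam + 3 * mu := by linarith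
  refine ((Set.finite_Iic ((4, N₁ + N₂, 3) : ℕ × ℕ × ℕ)).preimage
    DiskIndex.code_injective.injOn).subset fun i hi => ?_
  have hi : diskEigenvalue lam mu R i ≤ C := hi
  obtain k | _ | k | ⟨n, hn, k⟩ | ⟨n, hn, k⟩ := i
  · simp [DiskIndex.code, Prod.mk_le_mk]
  · simp [DiskIndex.code, Prod.mk_le_mk]
  · simp [DiskIndex.code, Prod.mk_le_mk]; omega
  · have h : n ≤ N₁ := by
      rw [diskEigenvalue, div_le_iff₀ hR] at hi
      have : (n : ℝ) ≤ C * R / (2 * mu) + 1 := by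
        rw [← sub_le_iff_le_add, le_div_iff₀ (by positivity)]
        linarith
      exact_mod_cast this.trans (Nat.le_ceil _)
    simp [DiskIndex.code, Prod.mk_le_mk]; omega
  · have h : n ≤ N₂ := by
      rw [diskEigenvalue, div_le_iff₀ (by positivity)] at hi
      have : (n : ℝ) ≤ C * ((lam + 3 * mu) * R) / (2 * mu * (lam + mu)) := by
        rw [le_div_iff₀ (by positivity)]
        have : 0 < 2 * mu * (lam + mu) := by positivity
        nlinarith
      exact_mod_cast this.trans (Nat.le_ceil _)
    simp [DiskIndex.code, Prod.mk_le_mk]; omega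

/-! ### The eigenspaces of the disk -/

lemma isClassicalMode_zero (lam mu R Λ : ℝ) : IsClassicalMode lam mu R Λ (fun _ => 0) :=
  ⟨contDiff_const, fun _ => 0, fun _ => 0, fun _ => 0, fun _ => 0,
    hasFDerivAt_wirtinger_const 0, by simpa using hasFDerivAt_wirtinger_const 0,
    fun z => ⟨0, by simpa using hasFDerivAt_wirtinger_const 0 z⟩, continuous_const,
    continuous_const, by simp, by simp⟩

lemma IsClassicalMode.smul_add {lam mu R Λ : ℝ} {U V : ℂ → ℂ} (hU : IsClassicalMode lam mu R Λ U)
    (hV : IsClassicalMode lam mu R Λ V) (s : ℝ) :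
    IsClassicalMode lam mu R Λ (fun z => s * U z + V z) := by
  obtain ⟨a, b, d, q, ha, hD, hQ, hd, hq, heq, hbd⟩ := hU.equations
  obtain ⟨a', b', d', q', ha', hD', hQ', hd', hq', heq', hbd'⟩ := hV.equations
  refine ⟨(contDiff_const.mul hU.contDiff).add hV.contDiff, fun z => s * a z + a' z,
    fun z => s * b z + b' z, fun z => s * d z + d' z, fun z => s * q z + q' z, fun z => ?_,
    fun z => ?_, fun z => ?_, by fun_prop, by fun_prop, fun z => ?_, fun z hz => ?_⟩
  · exact wirtinger_congr (hasFDerivAt_wirtinger_add (hasFDerivAt_wirtinger_mul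
      (hasFDerivAt_wirtinger_const s z) (ha z)) (ha' z)) (fun _ => rfl) (by ring) (by ring)
  · exact wirtinger_congr (hasFDerivAt_wirtinger_add (hasFDerivAt_wirtinger_mul
      (hasFDerivAt_wirtinger_const s z) (hD z)) (hD' z)) (fun _ => by simp; ring) (by ring)
      (by simp)
  · obtain ⟨p, hp⟩ := hQ z
    obtain ⟨p', hp'⟩ := hQ' z
    exact ⟨_, wirtinger_congr (hasFDerivAt_wirtinger_add (hasFDerivAt_wirtinger_mul
      (hasFDerivAt_wirtinger_const s z) hp) hp') (fun _ => by ring) (by ring) rfl⟩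
  · simp only [map_add, map_mul, Complex.conj_ofReal]
    linear_combination s * heq z + heq' z
  · have h1 := hbd z hz
    have h2 := hbd' z hz
    simp only [Complex.add_re, Complex.re_ofReal_mul]
    push_cast at h1 h2 ⊢
    linear_combination s * h1 + h2

/-- Linear combinations of modes for the same eigenvalue are classical solutions. -/
lemma isClassicalMode_sum {lam mu R Λ : ℝ} (hmu : 0 < mu) (hlam : 0 < lam + mu) (hR : 0 < R)
    (S : Finset DiskIndex) (hS : ∀ i ∈ S, diskEigenvalue lam mu R i = Λ) (a : DiskIndex → ℝ) :
    IsClassicalMode lam mu R Λ (fun z => ∑ i ∈ S, a i * modeC lam mu R i z) := by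
  classical
  induction S using Finset.induction_on with
  | empty => simpa using isClassicalMode_zero lam mu R Λ
  | insert i S hi ih =>
    simp only [Finset.sum_insert hi]
    have h := isClassicalMode_modeC hmu hlam hR i
    rw [hS i (Finset.mem_insert_self _ _)] at h
    exact h.smul_add (ih fun j hj => hS j (Finset.mem_insert_of_mem hj)) (a i)

lemma planeField_sum (c : Plane) (S : Finset DiskIndex) (a : DiskIndex → ℝ) (U : DiskIndex → ℂ → ℂ)
    (x : Plane) : planeField c (fun z => ∑ i ∈ S, a i * U i z) x =
      ∑ i ∈ S, a i • planeField c (U i) x := by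
  simp only [planeField, map_sum, ← Complex.real_smul, map_smul]

lemma integral_inner_mode_sum {lam mu R : ℝ} (hmu : 0 < mu) (hlam : 0 < lam + mu) (hR : 0 < R)
    (c : Plane) (S : Finset DiskIndex) (a : DiskIndex → ℝ) (i : DiskIndex) :
    ∫ x, inner ℝ (planeField c (modeC lam mu R i) x)
        (∑ j ∈ S, a j • planeField c (modeC lam mu R j) x) ∂circleMeasure c R =
      ∑ j ∈ S, a j * ∫ x, inner ℝ (planeField c (modeC lam mu R i) x)
        (planeField c (modeC lam mu R j) x) ∂circleMeasure c R := by
  have hm : ∀ i, MemLp (planeField c (modeC lam mu R i)) 2 (circleMeasure c R) := fun i =>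
    memLp_circle_of_continuous (contDiff_planeField
      (isClassicalMode_modeC hmu hlam hR i).contDiff).continuous c hR
  simp only [inner_sum, real_inner_smul_right]
  rw [integral_finsetSum _ fun j _ => (integrable_inner_of_memLp (hm i) (hm j)).const_mul (a j)]
  exact Finset.sum_congr rfl fun j _ => integral_const_mul _ _

lemma frob_hooke_strain_self_eq_zero {lam mu : ℝ} (hmu : 0 < mu) (hlam : 0 < lam + mu)
    {M : Matrix (Fin 2) (Fin 2) ℝ} (h : frob (hooke lam mu (strain M)) (strain M) = 0) (j : Fin 2) :
    M j j = 0 := by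
  rw [frob_hooke_strain, Complex.mul_conj, Complex.ofReal_re, Complex.normSq_apply] at h
  have h1 : (matDz M).re = 0 := by
    have h2 : (lam + mu) * ((matDz M).re * (matDz M).re) = 0 := by
      nlinarith [mul_nonneg hlam.le (mul_self_nonneg (matDz M).re),
        mul_nonneg hmu.le (mul_self_nonneg (matDzbar M).re),
        mul_nonneg hmu.le (mul_self_nonneg (matDzbar M).im)]
    simpa [hlam.ne'] using h2
  have h3 : (matDzbar M).re = 0 := by
    have h2 : mu * ((matDzbar M).re * (matDzbar M).re) = 0 := by
      nlinarith [mul_nonneg hlam.le (mul_self_nonneg (matDz M).re),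
        mul_nonneg hmu.le (mul_self_nonneg (matDzbar M).re),
        mul_nonneg hmu.le (mul_self_nonneg (matDzbar M).im)]
    simpa [hmu.ne'] using h2
  simp only [matDz, matDzbar] at h1 h3
  fin_cases j <;> simp only [Fin.zero_eta, Fin.mk_one] <;> linarith

lemma frob_hooke_strain_self_nonneg {lam mu : ℝ} (hmu : 0 < mu) (hlam : 0 < lam + mu)
    (M : Matrix (Fin 2) (Fin 2) ℝ) : 0 ≤ frob (hooke lam mu (strain M)) (strain M) := by
  rw [frob_hooke_strain, Complex.mul_conj, Complex.ofReal_re, mul_assoc (lam + mu)]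
  have := Complex.normSq_nonneg (matDzbar M)
  have := mul_self_nonneg (matDz M).re
  positivity

/-- Every solution is, on the disk, a linear combination of the modes for the same eigenvalue: its
trace is orthogonal to the modes for all other eigenvalues, and a solution of zero trace has zero
energy. -/
lemma IsSolution.exists_ae_eq_sum {lam mu R Λ : ℝ} (hmu : 0 < mu) (hlam : 0 < lam + mu)
    (hR : 0 < R) {c : Plane} {u : Plane → Plane}
    (hu : IsSolution (Metric.ball c R) (circleMeasure c R) lam mu Λ u) :
    ∃ (S : Finset DiskIndex) (a : DiskIndex → ℝ), (∀ i ∈ S, diskEigenvalue lam mu R i = Λ) ∧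
      u =ᵐ[volume.restrict (Metric.ball c R)]
        fun x => ∑ i ∈ S, a i • planeField c (modeC lam mu R i) x := by
  obtain ⟨G, g, hG, hg, heq⟩ := hu
  set w := fun i => planeField c (modeC lam mu R i) with hw
  set σ := circleMeasure c R with hσ
  have hmode := isClassicalMode_modeC hmu hlam hR
  have hws : ∀ i, ContDiff ℝ ∞ (w i) := fun i => contDiff_planeField (hmode i).contDiff
  have hwσ : ∀ i, MemLp (w i) 2 σ := fun i =>
    memLp_circle_of_continuous (hws i).continuous c hR
  -- the trace of `u` is orthogonal to the modes for other eigenvalues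
  have horth : ∀ i, diskEigenvalue lam mu R i ≠ Λ → ∫ x, inner ℝ (w i x) (g x) ∂σ = 0 := by
    intro i hi
    have h1 := (hmode i).weak_form hR c hG hg
    have h2 := heq (w i) _ _ (hasWeakJacobian_of_contDiff hR
      ((hws i).of_le (by exact_mod_cast le_top))) (isTrace_of_contDiff hR (hws i))
    have h3 : ∫ x in Metric.ball c R, frob (hooke lam mu (strain (G x))) (strain (jac (w i) x)) =
        ∫ x in Metric.ball c R, frob (hooke lam mu (strain (jac (w i) x))) (strain (G x)) :=
      integral_congr_ae (Eventually.of_forall fun x => frob_hooke_strain_comm _ _ _ _)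
    have h4 : ∫ x, inner ℝ (g x) (w i x) ∂σ = ∫ x, inner ℝ (w i x) (g x) ∂σ :=
      integral_congr_ae (Eventually.of_forall fun x => real_inner_comm _ _)
    have h5 : (diskEigenvalue lam mu R i - Λ) * ∫ x, inner ℝ (w i x) (g x) ∂σ = 0 := by
      rw [h3, h4] at h2
      rw [sub_mul, ← h2, ← h1, sub_self]
    exact (mul_eq_zero.1 h5).resolve_left (sub_ne_zero.2 hi)
  have hfin : {i | diskEigenvalue lam mu R i = Λ}.Finite :=
    (finite_diskEigenvalue_le hmu hlam hR Λ).subset fun i hi => le_of_eq hi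
  let S := hfin.toFinset
  have hS : ∀ i, i ∈ S ↔ diskEigenvalue lam mu R i = Λ := fun i => hfin.mem_toFinset
  let a : DiskIndex → ℝ := fun i =>
    (∫ x, inner ℝ (w i x) (g x) ∂σ) / ∫ x, inner ℝ (w i x) (w i x) ∂σ
  refine ⟨S, a, fun i hi => (hS i).1 hi, ?_⟩
  have hp := isClassicalMode_sum hmu hlam hR S (fun i hi => (hS i).1 hi) a
  set P : ℂ → ℂ := fun z => ∑ i ∈ S, a i * modeC lam mu R i z with hP
  set p := planeField c P with hp_def
  have hps : ContDiff ℝ ∞ p := contDiff_planeField hp.contDiff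
  have hpx : ∀ x, p x = ∑ i ∈ S, a i • w i x := planeField_sum c S a _
  have hpW := hasWeakJacobian_of_contDiff (c := c) hR
    (hps.of_le (by exact_mod_cast le_top) : ContDiff ℝ 1 p)
  have hpT := isTrace_of_contDiff (c := c) hR hps
  -- `u - p` is a solution whose trace is orthogonal to all modes
  have hdW := hG.comb (u := fun x => (1 : ℝ) • u x + (-1 : ℝ) • p x) 1 (-1) hpW
    (Eventually.of_forall fun _ => rfl)
  have hdT := IsTrace.comb (u := fun x => (1 : ℝ) • u x + (-1 : ℝ) • p x) 1 (-1) hG hpW hg hpT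
    (Eventually.of_forall fun _ => rfl)
  have hg0 : ∀ᵐ x ∂σ, (1 : ℝ) • g x + (-1 : ℝ) • p x = 0 := by
    refine ae_eq_zero_of_orthogonal_modes hmu hlam hR c hdT.1 fun i => ?_
    simp only [inner_add_right, real_inner_smul_right]
    rw [integral_add ((integrable_inner_of_memLp (hwσ i) hg.1).const_mul 1)
      ((integrable_inner_of_memLp (hwσ i) hpT.1).const_mul (-1)), integral_const_mul,
      integral_const_mul]
    simp only [hpx]
    rw [integral_inner_mode_sum hmu hlam hR]
    by_cases hi : i ∈ S
    · rw [Finset.sum_eq_single_of_mem i hi fun j _ hj => by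
        rw [integral_inner_modes_of_ne hmu hlam hR c hj.symm, mul_zero]]
      have := (integral_inner_mode_self_pos hmu hlam hR c i).ne'
      simp only [a]
      rw [div_mul_cancel₀ _ this]
      ring
    · rw [horth i (fun h => hi ((hS i).2 h)), Finset.sum_eq_zero fun j hj => by
        rw [integral_inner_modes_of_ne hmu hlam hR c (by rintro rfl; exact hi hj), mul_zero]]
      ring
  -- so it has zero energy
  have hE : ∫ x in Metric.ball c R,
      frob (hooke lam mu (strain ((1 : ℝ) • G x + (-1 : ℝ) • jac p x)))
        (strain ((1 : ℝ) • G x + (-1 : ℝ) • jac p x)) = 0 := by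
    have h1 := heq _ _ _ hdW hdT
    have h2 := hp.weak_form hR c hdW hdT
    have hz : ∀ h : Plane → Plane,
        ∫ x, inner ℝ (h x) ((1 : ℝ) • g x + (-1 : ℝ) • p x) ∂σ = 0 := fun h =>
      integral_eq_zero_of_ae (hg0.mono fun x hx => by
        simp only [hx, inner_zero_right, Pi.zero_apply])
    rw [hz, mul_zero] at h1 h2
    simp only [frob_hooke_strain_comb lam mu 1 (-1)]
    rw [integral_add ((integrable_frob hG.memLp_jacobian hdW.memLp_jacobian).const_mul 1)
      ((integrable_frob hpW.memLp_jacobian hdW.memLp_jacobian).const_mul (-1)), integral_const_mul,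
      integral_const_mul, h1, h2]
    simp
  rw [integral_eq_zero_iff_of_nonneg (fun x => frob_hooke_strain_self_nonneg hmu hlam _)
    (integrable_frob hdW.memLp_jacobian hdW.memLp_jacobian)] at hE
  have hzero := ae_eq_zero_of_trace_zero hR hdW hdT hg0
    (hE.mono fun x hx => frob_hooke_strain_self_eq_zero hmu hlam hx)
  filter_upwards [hzero] with x hx
  rw [← hpx]
  rw [one_smul, neg_one_smul, ← sub_eq_add_neg, sub_eq_zero] at hx
  exact hx

lemma memLp_diskMode {lam mu R : ℝ} (hmu : 0 < mu) (hlam : 0 < lam + mu) (hR : 0 < R) (c : Plane)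
    (i : DiskIndex) : MemLp (diskMode lam mu c R i) 2 (volume.restrict (Metric.ball c R)) := by
  rw [diskMode_eq hlam]
  exact memLp_ball_of_continuous
    (contDiff_planeField (isClassicalMode_modeC hmu hlam hR i).contDiff).continuous c R

lemma coeFn_sum_toLp {c : Plane} {R : ℝ} {w : DiskIndex → Plane → Plane}
    (hw : ∀ i, MemLp (w i) 2 (volume.restrict (Metric.ball c R))) (S : Finset DiskIndex)
    (a : DiskIndex → ℝ) :
    ⇑(∑ i ∈ S, a i • (hw i).toLp) =ᵐ[volume.restrict (Metric.ball c R)]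
      fun x => ∑ i ∈ S, a i • w i x := by
  have h : ∀ i, ∀ᵐ x ∂volume.restrict (Metric.ball c R), (a i • (hw i).toLp : Lp Plane 2 _) x =
      a i • w i x := fun i => by
    filter_upwards [Lp.coeFn_smul (a i) (hw i).toLp, (hw i).coeFn_toLp] with x h1 h2
    rw [h1, Pi.smul_apply, h2]
  filter_upwards [Lp.coeFn_fun_finsetSum S fun i => a i • (hw i).toLp, ae_all_iff.2 h] with x h1 h2
  rw [h1]
  exact Finset.sum_congr rfl fun i _ => h2 i

/-- The modes are linearly independent: a linear combination that vanishes on the disk vanishes on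
its boundary, where the modes are orthogonal. -/
lemma linearIndependent_diskMode {lam mu R : ℝ} (hmu : 0 < mu) (hlam : 0 < lam + mu) (hR : 0 < R)
    (c : Plane) :
    LinearIndependent ℝ (fun i : DiskIndex => (memLp_diskMode hmu hlam hR c i).toLp) := by
  rw [linearIndependent_iff']
  intro S a hsum i hi
  have h0 := coeFn_sum_toLp (fun i => memLp_diskMode hmu hlam hR c i) S a
  rw [hsum] at h0
  have hcont : Continuous fun x => ∑ i ∈ S, a i • planeField c (modeC lam mu R i) x :=
    continuous_finsetSum _ fun i _ => ((contDiff_planeField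
      (isClassicalMode_modeC hmu hlam hR i).contDiff).continuous).const_smul (a i)
  have hball : Set.EqOn (fun x => ∑ i ∈ S, a i • planeField c (modeC lam mu R i) x) (fun _ => 0)
      (Metric.ball c R) := by
    refine Measure.eqOn_open_of_ae_eq (μ := volume) ?_ Metric.isOpen_ball hcont.continuousOn
      continuousOn_const
    filter_upwards [h0, Lp.coeFn_zero Plane 2 (volume.restrict (Metric.ball c R))] with x h1 h2
    simp only [diskMode_eq hlam] at h1
    rw [← h1, h2, Pi.zero_apply]
  have hclosed := hball.closure hcont continuous_const
  rw [closure_ball c hR.ne'] at hclosed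
  have h1 := integral_inner_mode_sum hmu hlam hR c S a i
  rw [integral_eq_zero_of_ae ((ae_circleMeasure_mem_sphere hR).mono fun x hx => by
      have := hclosed (Metric.sphere_subset_closedBall hx)
      simp only at this
      rw [this, inner_zero_right, Pi.zero_apply]),
    Finset.sum_eq_single_of_mem i hi fun j _ hj => by
      rw [integral_inner_modes_of_ne hmu hlam hR c hj.symm, mul_zero]] at h1
  exact (mul_eq_zero.1 h1.symm).resolve_right (integral_inner_mode_self_pos hmu hlam hR c i).ne'

lemma eigenspace_eq_span {lam mu R : ℝ} (hmu : 0 < mu) (hlam : 0 < lam + mu) (hR : 0 < R)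
    (c : Plane) (Λ : ℝ) :
    eigenspace (Metric.ball c R) (circleMeasure c R) lam mu Λ =
      Submodule.span ℝ ((fun i : DiskIndex => (memLp_diskMode hmu hlam hR c i).toLp) ''
        {i | diskEigenvalue lam mu R i = Λ}) := by
  apply le_antisymm
  · intro u hu
    obtain ⟨S, a, hS, h⟩ := IsSolution.exists_ae_eq_sum hmu hlam hR hu
    have hu' : u = ∑ i ∈ S, a i • (memLp_diskMode hmu hlam hR c i).toLp := by
      simp only [← diskMode_eq hlam] at h
      exact Lp.ext (h.trans (coeFn_sum_toLp (memLp_diskMode hmu hlam hR c) S a).symm)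
    rw [hu']
    exact Submodule.sum_mem _ fun i hi => Submodule.smul_mem _ _
      (Submodule.subset_span ⟨i, hS i hi, rfl⟩)
  · rw [Submodule.span_le]
    rintro _ ⟨i, rfl, rfl⟩
    have h := (isClassicalMode_modeC hmu hlam hR i).isSolution hR c
    refine IsSolution.comb 1 0 h h ?_
    filter_upwards [(memLp_diskMode hmu hlam hR c i).coeFn_toLp] with x hx
    rw [one_smul, zero_smul, add_zero, hx, diskMode_eq hlam]

lemma rank_eigenspace {lam mu R : ℝ} (hmu : 0 < mu) (hlam : 0 < lam + mu) (hR : 0 < R)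
    (c : Plane) (Λ : ℝ) :
    Module.rank ℝ (eigenspace (Metric.ball c R) (circleMeasure c R) lam mu Λ) =
      Cardinal.mk {i : DiskIndex // diskEigenvalue lam mu R i = Λ} := by
  have hli := (linearIndependent_diskMode hmu hlam hR c).comp
    (Subtype.val : {i : DiskIndex // diskEigenvalue lam mu R i = Λ} → DiskIndex)
    Subtype.val_injective
  have h := rank_span hli
  rw [Cardinal.mk_range_eq _ hli.injective, Set.range_comp, Subtype.range_coe_subtype] at h
  rw [eigenspace_eq_span hmu hlam hR c Λ]
  exact h

end SteklovLame

end

theorem theorem1 (lam mu : ℝ) (hmu : 0 < mu) (hlam : 0 < lam + mu)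
    (c : SteklovLame.Plane) (R : ℝ) (hR : 0 < R) :
    (∃ s : ℕ → ℝ,
      SteklovLame.IsSortedSpectrum (Metric.ball c R) (SteklovLame.circleMeasure c R) lam mu s ∧
      ∃ e : ℕ ≃ SteklovLame.DiskIndex, ∀ k, s k = SteklovLame.diskEigenvalue lam mu R (e k)) ∧
    ∃ hmem : ∀ i : SteklovLame.DiskIndex, MemLp (SteklovLame.diskMode lam mu c R i) 2
        (volume.restrict (Metric.ball c R)),
      LinearIndependent ℝ (fun i : SteklovLame.DiskIndex => (hmem i).toLp) ∧
      ∀ Λ : ℝ,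
        SteklovLame.eigenspace (Metric.ball c R) (SteklovLame.circleMeasure c R) lam mu Λ =
          Submodule.span ℝ ((fun i : SteklovLame.DiskIndex => (hmem i).toLp) ''
            {i | SteklovLame.diskEigenvalue lam mu R i = Λ}) := by
  have hfin := SteklovLame.finite_diskEigenvalue_le hmu hlam hR
  refine ⟨?_, SteklovLame.memLp_diskMode hmu hlam hR c,
    SteklovLame.linearIndependent_diskMode hmu hlam hR c,
    SteklovLame.eigenspace_eq_span hmu hlam hR c⟩
  obtain ⟨e, he⟩ := SteklovLame.exists_equiv_monotone (SteklovLame.diskEigenvalue lam mu R) hfin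
  refine ⟨SteklovLame.diskEigenvalue lam mu R ∘ e, ⟨he, ?_, fun Λ => ?_⟩, e, fun _ => rfl⟩
  · refine tendsto_atTop_atTop_of_monotone he fun C => ?_
    by_contra! h
    refine Set.infinite_univ ((hfin C).subset fun i _ => ?_)
    have := h (e.symm i)
    simp only [Function.comp_apply, Equiv.apply_symm_apply] at this
    exact this.le
  · rw [SteklovLame.rank_eigenspace hmu hlam hR c Λ]
    exact Cardinal.mk_congr (e.subtypeEquiv fun k => Iff.rfl).symm
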